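/- Let $(M,g)$ be a Kähler–Einstein manifold of complex dimension $n$, with Kähler form $\omega=\frac i2\sum g_{\alpha\bar\beta}\,dz_\alpha\wedge d\bar z_\beta$ and Ricci form $\rho=-i\,\partial\bar\partial\log\det(g_{\alpha\bar\beta})$ satisfying $\rho=\lambda\omega$ for some constant $\lambda\in\mathbb R$. Let $N$ be a (finite) natural number, let $b\le 0$, and let $F(N,b)$ be the complex space form of holomorphic sectional curvature $4b$: for $b=0$ it is $\mathbb C^N$ with the flat metric, i.e. the metric with Kähler potential $\sum_j|z_j|^2$; for $b<0$ it is the complex hyperbolic space, i.e. the ball $\{z\in\mathbb C^N : \sum_j|z_j|^2<-1/b\}$ with the metric of Kähler potential $\frac1b\log\bigl(1+b\sum_j|z_j|^2\bigr)$ (so that $b=-1$ gives $\mathbb C\mathrm H^N$). If $f\colon M\to F(N,b)$ is a Kähler immersion, that is, a holomorphic and isometric immersion, then $M$ is totally geodesic in $F(N,b)$: the second fundamental form of $f$ vanishes identically. -/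

import Mathlib

open scoped Manifold ContDiff

noncomputable section

namespace KahlerGeometry

/-- Complex coordinate space `ℂ^m` (with its Euclidean norm). -/
abbrev Cn (m : ℕ) : Type := EuclideanSpace ℂ (Fin m)

/-! ### Wirtinger derivatives on `ℂ^m` -/

/-- `∂F/∂z_j = (1/2) (∂F/∂x_j - i ∂F/∂y_j)`. -/
def dz {m : ℕ} (F : Cn m → ℂ) (j : Fin m) (z : Cn m) : ℂ :=
  (1 / 2) * (fderiv ℝ F z (EuclideanSpace.single j 1)
    - Complex.I * fderiv ℝ F z (EuclideanSpace.single j Complex.I))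

/-- `∂F/∂z̄_j = (1/2) (∂F/∂x_j + i ∂F/∂y_j)`. -/
def dzbar {m : ℕ} (F : Cn m → ℂ) (j : Fin m) (z : Cn m) : ℂ :=
  (1 / 2) * (fderiv ℝ F z (EuclideanSpace.single j 1)
    + Complex.I * fderiv ℝ F z (EuclideanSpace.single j Complex.I))

/-- The complex Hessian `∂²φ/∂z_j∂z̄_k` of a real function `φ`. -/
def complexHessian {m : ℕ} (φ : Cn m → ℝ) (z : Cn m) (j k : Fin m) : ℂ :=
  dz (dzbar (fun w => (φ w : ℂ)) k) j z

/-! ### Kähler metrics on complex manifolds -/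

section Manifold

variable (n : ℕ) (M : Type*) [TopologicalSpace M] [ChartedSpace (Cn n) M]

/-- A field of sesquilinear forms (linear in the first, conjugate-linear in the second variable)
on the holomorphic tangent spaces of a complex manifold. -/
abbrev SesquilinearField : Type _ :=
  ∀ p : M, TangentSpace 𝓘(ℂ, Cn n) p →ₗ[ℂ] TangentSpace 𝓘(ℂ, Cn n) p →ₗ⋆[ℂ] ℂ

variable {n M}

/-- The expression of `h` in the chart `e`: at the point `x` of the coordinate domain it is the
pull-back of `h` under the parametrization `e.symm`. -/
def inChart (h : SesquilinearField n M) (e : OpenPartialHomeomorph M (Cn n))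
    (x u v : Cn n) : ℂ :=
  h (e.symm x) (mfderiv 𝓘(ℂ, Cn n) 𝓘(ℂ, Cn n) e.symm x u)
    (mfderiv 𝓘(ℂ, Cn n) 𝓘(ℂ, Cn n) e.symm x v)

variable (n M)

/-- A Kähler metric on a complex manifold of dimension `n`: a smooth Hermitian metric `h`, with
Riemannian metric `g = Re h` and fundamental form `ω(u, v) = g(iu, v)`, such that `dω = 0`. -/
structure KahlerMetric where
  /-- the Hermitian metric -/
  form : SesquilinearField n M
  hermitian : ∀ (p : M) (u v : TangentSpace 𝓘(ℂ, Cn n) p),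
    form p v u = (starRingEnd ℂ) (form p u v)
  pos_def : ∀ (p : M) (u : TangentSpace 𝓘(ℂ, Cn n) p), u ≠ 0 → 0 < (form p u u).re
  smooth : ∀ e ∈ atlas (Cn n) M, ∀ u v : Cn n,
    ContDiffOn ℝ ∞ (fun x => inChart form e x u v) e.target
  /-- `dω = 0`, evaluated on constant vector fields in a chart -/
  closed : ∀ e ∈ atlas (Cn n) M, ∀ x ∈ e.target, ∀ u v w : Cn n,
    fderiv ℝ (fun y => (inChart form e y (Complex.I • v) w).re) x u
      + fderiv ℝ (fun y => (inChart form e y (Complex.I • w) u).re) x v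
      + fderiv ℝ (fun y => (inChart form e y (Complex.I • u) v).re) x w = 0

variable {n M}

/-- The coefficients `g_{αβ̄}` in a chart; thus `ω = (i/2) ∑ g_{αβ̄} dz_α ∧ dz̄_β`. -/
def KahlerMetric.coeff (g : KahlerMetric n M) (e : OpenPartialHomeomorph M (Cn n)) (x : Cn n) :
    Matrix (Fin n) (Fin n) ℂ :=
  fun α β => inChart g.form e x (EuclideanSpace.single α 1) (EuclideanSpace.single β 1)

/-- The coefficients of the Ricci form `ρ = -i ∂∂̄ log det (g_{αβ̄})` in a chart, normalized like
those of `ω`, that is `ρ = (i/2) ∑ ρ_{αβ̄} dz_α ∧ dz̄_β` with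
`ρ_{αβ̄} = -2 ∂²/∂z_α∂z̄_β log det (g)`. (The determinant of the positive definite Hermitian matrix
`(g_{αβ̄})` is a positive real number.) -/
def KahlerMetric.ricciCoeff (g : KahlerMetric n M) (e : OpenPartialHomeomorph M (Cn n))
    (x : Cn n) : Matrix (Fin n) (Fin n) ℂ :=
  fun α β => -2 * complexHessian (fun y => Real.log (g.coeff e y).det.re) x α β

/-- `(M, g)` is Kähler–Einstein: `ρ = lam • ω` for some real constant `lam`. -/
def KahlerMetric.IsEinstein (g : KahlerMetric n M) : Prop :=
  ∃ lam : ℝ, ∀ e ∈ atlas (Cn n) M, ∀ x ∈ e.target, ∀ α β : Fin n,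
    g.ricciCoeff e x α β = (lam : ℂ) * g.coeff e x α β

end Manifold

/-! ### The complex space forms of non-positive curvature -/

/-- The underlying domain of the space form `F(N, b)`, `b ≤ 0`: the whole of `ℂ^N` for `b = 0`, the
ball `‖z‖² < -1/b` for `b < 0`. -/
def spaceFormDomain (N : ℕ) (b : ℝ) : Set (Cn N) :=
  {z | 0 < 1 + b * ‖z‖ ^ 2}

/-- The Kähler potential (diastasis centered at the origin) of `F(N, b)`: `∑ |z_j|²` for `b = 0`,
`(1/b) log (1 + b ∑ |z_j|²)` for `b < 0`. -/
def spaceFormPotential (N : ℕ) (b : ℝ) (z : Cn N) : ℝ :=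
  if b = 0 then ‖z‖ ^ 2 else (1 / b) * Real.log (1 + b * ‖z‖ ^ 2)

/-- The Hermitian metric of `F(N, b)`: flat for `b = 0`, complex hyperbolic of holomorphic
sectional curvature `4 b` for `b < 0`. -/
def spaceFormHermitian (N : ℕ) (b : ℝ) (z u v : Cn N) : ℂ :=
  ∑ j, ∑ k, complexHessian (spaceFormPotential N b) z j k * u j * (starRingEnd ℂ) (v k)

/-- The Riemannian metric of `F(N, b)`. -/
def spaceFormMetric (N : ℕ) (b : ℝ) (z u v : Cn N) : ℝ :=
  (spaceFormHermitian N b z u v).re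

/-- The Levi-Civita connection of `F(N, b)` (Christoffel symbols of the first kind): for the
constant vector fields `u`, `v`, `w` this is the inner product of `∇_u v` with `w` at `z`,
as given by the Koszul formula. -/
def christoffel (N : ℕ) (b : ℝ) (z u v w : Cn N) : ℝ :=
  (1 / 2) * (fderiv ℝ (fun y => spaceFormMetric N b y v w) z u
    + fderiv ℝ (fun y => spaceFormMetric N b y u w) z v
    - fderiv ℝ (fun y => spaceFormMetric N b y u v) z w)

/-! ### Kähler immersions and total geodesy -/

section Immersion

variable {n N : ℕ} {M : Type*} [TopologicalSpace M] [ChartedSpace (Cn n) M]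

/-- A Kähler immersion of `(M, g)` into `F(N, b)`: a holomorphic map into the space form which is
isometric (and hence an immersion). -/
structure IsKahlerImmersion (g : KahlerMetric n M) (b : ℝ) (f : M → Cn N) : Prop where
  mem_domain : ∀ p, f p ∈ spaceFormDomain N b
  holomorphic : ContMDiff 𝓘(ℂ, Cn n) 𝓘(ℂ, Cn N) ω f
  isometric : ∀ (p : M) (u v : TangentSpace 𝓘(ℂ, Cn n) p),
    spaceFormHermitian N b (f p) (mfderiv 𝓘(ℂ, Cn n) 𝓘(ℂ, Cn N) f p u)
      (mfderiv 𝓘(ℂ, Cn n) 𝓘(ℂ, Cn N) f p v) = g.form p u v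

/-- For a map `F` from a coordinate domain into `F(N, b)`, constant coordinate fields `u`, `v`
and `ξ` in the ambient tangent space at `F x`, the inner product of `∇_u (dF v)` with `ξ`.
If `ξ` is normal to the image of `dF`, this is the inner product of the second fundamental form
`II(u, v)` with `ξ`. -/
def ambientCovariantDerivative (b : ℝ) (F : Cn n → Cn N) (x u v : Cn n) (ξ : Cn N) : ℝ :=
  spaceFormMetric N b (F x) (fderiv ℝ (fun y => fderiv ℝ F y v) x u) ξ
    + christoffel N b (F x) (fderiv ℝ F x u) (fderiv ℝ F x v) ξ

/-- `M`, immersed into `F(N, b)` by `f`, is totally geodesic: its second fundamental form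
vanishes, i.e. all its components along normal vectors `ξ` are zero. -/
def IsTotallyGeodesic (b : ℝ) (f : M → Cn N) : Prop :=
  ∀ e ∈ atlas (Cn n) M, ∀ x ∈ e.target, ∀ (u v : Cn n) (ξ : Cn N),
    (∀ w : Cn n, spaceFormMetric N b (f (e.symm x)) (fderiv ℝ (f ∘ e.symm) x w) ξ = 0) →
      ambientCovariantDerivative b (f ∘ e.symm) x u v ξ = 0

end Immersion

end KahlerGeometry

end

/-! The argument compares a kernel of finite rank with one of infinite rank. Work in a chart, along
a complex line `ζ ↦ x + ζ • u`, and let `F` be the immersion in the chart and `Φ` the potential of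
the space form. Since the induced metric is `∂∂̄(Φ ∘ F)`, the Einstein equation says that `log det g
+ (λ/2) Φ ∘ F` is harmonic along the line (`IsKahlerImmersion.harmonicOnNhd`).

Regard `F(N, b)` through the form `s t̄ + b ∑ x_l ȳ_l` on `ℂ^(N+1)`. The vectors `(1, F)` and `(0,
∂_i F)` have bordered Gram determinant `(1 + b‖F‖²)^(n+1) det g` (`det_frame`). As `log (1 + b‖F‖²)
= bΦ`, its logarithm is `c Φ ∘ F` plus a harmonic function, where `c = (n+1)b - λ/2`. Polarization
(`exists_factorization`) turns this into an identity in two independent points `z`, `w`: the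
determinant with rows taken at `z` and columns at `w` equals a function of `z` times a function of
`w` times `exp (c ψ(⟨F(z), F(w)⟩))`.

The determinant is a finite sum of products of a function of `z` and a function of `w`; this is
where the finiteness of `N` enters. For `c > 0` the power series of `exp (c ψ)` has positive
coefficients only, so its kernel is strictly positive definite on arbitrarily many points and has
infinite rank. Hence `c ≤ 0` (`nonpos_of_factorization`).

The mixed logarithmic derivative of the same identity at the base point is the traced Gauss equation
(`trace_gauss`): `tr (G⁻¹ Gram(ν)) = c ‖F'‖²`, with `ν_i` the normal part of the derivative of `∂_i
F`. The left side is nonnegative and the right side nonpositive, so all `ν_i` vanish. The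
Christoffel terms of the space form contribute nothing in normal directions, so the second
fundamental form is zero. -/

namespace KahlerGeometry

open Complex ComplexConjugate Metric

/-! ### Polarization -/

/-- A holomorphic function of two variables which vanishes on `w = z̄` vanishes. -/
theorem eq_zero_of_eq_zero_conj {H : ℂ × ℂ → ℂ} {r : ℝ}
    (hH : DifferentiableOn ℂ H (ball 0 r ×ˢ ball 0 r))
    (h0 : ∀ z ∈ ball (0 : ℂ) r, H (z, conj z) = 0) {z w : ℂ}
    (hz : z ∈ ball (0 : ℂ) (r / 2)) (hw : w ∈ ball (0 : ℂ) (r / 2)) : H (z, w) = 0 := by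
  rw [mem_ball_zero_iff] at hz hw
  have hr : 0 < r / 2 := (norm_nonneg z).trans_lt hz
  -- In the coordinates `z = u + iv`, `w = u - iv`, the set `w = z̄` is given by real `u` and `v`,
  -- so the one-variable identity theorem can be applied twice. Halving the radius keeps `u ± iv` in
  -- the original ball.
  set G : ℂ → ℂ → ℂ := fun u v => H (u + I * v, u - I * v) with hG
  have hmem : ∀ u ∈ ball (0 : ℂ) (r / 2), ∀ v ∈ ball (0 : ℂ) (r / 2),
      (u + I * v, u - I * v) ∈ ball (0 : ℂ) r ×ˢ ball (0 : ℂ) r := by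
    intro u hu v hv
    rw [mem_ball_zero_iff] at hu hv
    simp only [Set.mem_prod, mem_ball_zero_iff]
    constructor
    · calc ‖u + I * v‖ ≤ ‖u‖ + ‖I * v‖ := norm_add_le _ _
        _ < r := by simp; linarith
    · calc ‖u - I * v‖ ≤ ‖u‖ + ‖I * v‖ := norm_sub_le _ _
        _ < r := by simp; linarith
  have hopen : IsOpen (ball (0 : ℂ) r ×ˢ ball (0 : ℂ) r) := isOpen_ball.prod isOpen_ball
  have key : ∀ g : ℂ → ℂ, DifferentiableOn ℂ g (ball 0 (r / 2)) →
      (∀ t : ℝ, (t : ℂ) ∈ ball (0 : ℂ) (r / 2) → g t = 0) →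
      ∀ v ∈ ball (0 : ℂ) (r / 2), g v = 0 := by
    intro g hg hreal v hv
    refine (hg.analyticOnNhd isOpen_ball).eqOn_zero_of_preconnected_of_frequently_eq_zero
      (convex_ball _ _).isPreconnected (mem_ball_self hr) ?_ hv
    have h1 : Filter.Tendsto (fun t : ℝ => (t : ℂ)) (nhdsWithin 0 {0}ᶜ) (nhdsWithin 0 {0}ᶜ) := by
      refine tendsto_nhdsWithin_of_tendsto_nhds_of_eventually_within _ ?_ ?_
      · exact (Complex.continuous_ofReal.tendsto' 0 0 (by simp)).mono_left nhdsWithin_le_nhds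
      · filter_upwards [self_mem_nhdsWithin] with t ht
        simpa using ht
    refine h1.frequently (Filter.Eventually.frequently ?_)
    have h2 : ∀ᶠ t : ℝ in nhdsWithin 0 {0}ᶜ, (t : ℂ) ∈ ball (0 : ℂ) (r / 2) :=
      ((Complex.continuous_ofReal.tendsto' 0 0 (by simp)).eventually
        (ball_mem_nhds 0 hr)).filter_mono nhdsWithin_le_nhds
    filter_upwards [h2] with t ht using hreal t ht
  have hdv : ∀ u ∈ ball (0 : ℂ) (r / 2), DifferentiableOn ℂ (fun v => G u v) (ball 0 (r / 2)) := by
    intro u hu v hv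
    exact ((hH.differentiableAt (hopen.mem_nhds (hmem u hu v hv))).comp
      (f := fun v => (u + I * v, u - I * v)) v (by fun_prop)).differentiableWithinAt
  have hdu : ∀ v ∈ ball (0 : ℂ) (r / 2), DifferentiableOn ℂ (fun u => G u v) (ball 0 (r / 2)) := by
    intro v hv u hu
    exact ((hH.differentiableAt (hopen.mem_nhds (hmem u hu v hv))).comp
      (f := fun u => (u + I * v, u - I * v)) u (by fun_prop)).differentiableWithinAt
  have step1 : ∀ u : ℝ, (u : ℂ) ∈ ball (0 : ℂ) (r / 2) → ∀ v ∈ ball (0 : ℂ) (r / 2),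
      G u v = 0 := by
    intro u hu
    refine key _ (hdv u hu) fun t ht => ?_
    have := h0 (u + I * t) (hmem u hu t ht).1
    simpa [hG, sub_eq_add_neg] using this
  have step2 : ∀ v ∈ ball (0 : ℂ) (r / 2), ∀ u ∈ ball (0 : ℂ) (r / 2), G u v = 0 :=
    fun v hv => key _ (hdu v hv) fun t ht => step1 t ht v hv
  have hu' : (z + w) / 2 ∈ ball (0 : ℂ) (r / 2) := by
    rw [mem_ball_zero_iff, norm_div]
    have := norm_add_le z w
    simp; linarith
  have hv' : (z - w) / (2 * I) ∈ ball (0 : ℂ) (r / 2) := by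
    rw [mem_ball_zero_iff, norm_div]
    have := norm_sub_le z w
    simp; linarith
  have := step2 _ hv' _ hu'
  have e : I * ((z - w) / (2 * I)) = (z - w) / 2 := by
    field_simp
  simp only [hG, e] at this
  convert this using 3 <;> ring

/-! ### Kernels of finite rank -/

/-- A kernel which is a finite sum of products of functions of one variable. -/
def IsFiniteRankKernel {X Y : Type*} (K : X → Y → ℂ) : Prop :=
  ∃ (ι : Type) (_ : Fintype ι) (φ : ι → X → ℂ) (ψ : ι → Y → ℂ),
    ∀ x y, K x y = ∑ i, φ i x * ψ i y

namespace IsFiniteRankKernel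

variable {X Y : Type*} {K K' : X → Y → ℂ}

theorem mul_fun (φ : X → ℂ) (ψ : Y → ℂ) : IsFiniteRankKernel fun x y => φ x * ψ y :=
  ⟨Unit, inferInstance, fun _ => φ, fun _ => ψ, by simp⟩

theorem const (c : ℂ) : IsFiniteRankKernel fun (_ : X) (_ : Y) => c := by
  simpa using mul_fun (X := X) (Y := Y) (fun _ => c) (fun _ => 1)

theorem add (h : IsFiniteRankKernel K) (h' : IsFiniteRankKernel K') :
    IsFiniteRankKernel fun x y => K x y + K' x y := by
  obtain ⟨ι, _, φ, ψ, h⟩ := h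
  obtain ⟨ι', _, φ', ψ', h'⟩ := h'
  exact ⟨ι ⊕ ι', inferInstance, Sum.elim φ φ', Sum.elim ψ ψ', by simp [h, h']⟩

theorem mul (h : IsFiniteRankKernel K) (h' : IsFiniteRankKernel K') :
    IsFiniteRankKernel fun x y => K x y * K' x y := by
  obtain ⟨ι, _, φ, ψ, h⟩ := h
  obtain ⟨ι', _, φ', ψ', h'⟩ := h'
  refine ⟨ι × ι', inferInstance, fun p x => φ p.1 x * φ' p.2 x, fun p y => ψ p.1 y * ψ' p.2 y, ?_⟩
  intro x y
  simp only [h, h']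
  rw [Finset.sum_mul_sum, Fintype.sum_prod_type]
  exact Finset.sum_congr rfl fun i _ => Finset.sum_congr rfl fun j _ => by ring

theorem sum {ι : Type*} (s : Finset ι) {k : ι → X → Y → ℂ}
    (h : ∀ i, IsFiniteRankKernel (k i)) : IsFiniteRankKernel fun x y => ∑ i ∈ s, k i x y := by
  classical
  induction s using Finset.induction_on with
  | empty => simpa using const (X := X) (Y := Y) 0
  | insert a s ha ih => simpa [Finset.sum_insert ha] using (h a).add ih

theorem prod {ι : Type*} (s : Finset ι) {k : ι → X → Y → ℂ}
    (h : ∀ i, IsFiniteRankKernel (k i)) : IsFiniteRankKernel fun x y => ∏ i ∈ s, k i x y := by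
  classical
  induction s using Finset.induction_on with
  | empty => simpa using const (X := X) (Y := Y) 1
  | insert a s ha ih => simpa [Finset.prod_insert ha] using (h a).mul ih

/-- By the Leibniz formula, since finite rank kernels are closed under sums and products. No
regularity of the entries is needed. -/
theorem det {ι κ : Type*} [Fintype ι] [DecidableEq ι] [Fintype κ] (A : X → Matrix ι κ ℂ)
    (B : Y → Matrix κ ι ℂ) : IsFiniteRankKernel fun x y => (A x * B y).det := by
  simp only [Matrix.det_apply', Matrix.mul_apply]
  exact sum _ fun σ => (const _).mul (prod _ fun i => sum _ fun j =>
    mul_fun (fun x => A x (σ i) j) (fun y => B y j i))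

/-- The columns of a finite rank kernel at sufficiently many points are linearly dependent. -/
theorem exists_sum_mul_eq_zero (h : IsFiniteRankKernel K) :
    ∃ m : ℕ, ∀ y : Fin m → Y, ∃ v : Fin m → ℂ, v ≠ 0 ∧ ∀ x, ∑ j, K x (y j) * v j = 0 := by
  obtain ⟨ι, _, φ, ψ, h⟩ := h
  -- One more point than the number of terms: the matrix `ψ i (y j)` then has more columns than
  -- rows, and any nonzero kernel vector works for all `x` at once.
  refine ⟨Fintype.card ι + 1, fun y => ?_⟩
  have := LinearMap.ker_ne_bot_of_finrank_lt
    (f := (Matrix.of fun (i : ι) j => ψ i (y j)).mulVecLin) (by simp)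
  obtain ⟨v, hv, hv0⟩ := Submodule.exists_mem_ne_zero_of_ne_bot this
  refine ⟨v, hv0, fun x => ?_⟩
  simp_rw [h, Finset.sum_mul]
  rw [Finset.sum_comm]
  refine Finset.sum_eq_zero fun i _ => ?_
  have hi := congrFun (LinearMap.mem_ker.1 hv) i
  simp only [Matrix.mulVecLin_apply, Matrix.mulVec, dotProduct, Matrix.of_apply,
    Pi.zero_apply] at hi
  simp_rw [mul_assoc, ← Finset.mul_sum, hi, mul_zero]

end IsFiniteRankKernel

/-! ### Strictly positive kernels -/

/-- The `k`-th power of a Gram matrix entry is the inner product of `k`-fold tensor powers; expanded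
over multi-indices `t`, its quadratic form becomes a sum of squares. -/
theorem sum_conj_mul_pow_mul {N m : ℕ} (p : Fin m → Fin N → ℂ) (v : Fin m → ℂ) (k : ℕ) :
    ∑ i, conj (v i) * ∑ j, (∑ l, p i l * conj (p j l)) ^ k * v j
      = ((∑ t : Fin k → Fin N, ‖∑ i, conj (v i) * ∏ s, p i (t s)‖ ^ 2 : ℝ) : ℂ) := by
  have h1 : ∀ i j, (∑ l, p i l * conj (p j l)) ^ k
      = ∑ t : Fin k → Fin N, (∏ s, p i (t s)) * conj (∏ s, p j (t s)) := by
    intro i j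
    rw [Fintype.sum_pow]
    simp [Finset.prod_mul_distrib]
  push_cast
  simp_rw [h1, ← Complex.mul_conj', map_sum, Finset.sum_mul_sum, Finset.sum_mul, Finset.mul_sum]
  refine ((Finset.sum_congr rfl fun i _ => Finset.sum_comm).trans Finset.sum_comm).trans ?_
  refine Finset.sum_congr rfl fun t _ => Finset.sum_congr rfl fun i _ =>
    Finset.sum_congr rfl fun j _ => ?_
  simp only [map_mul, Complex.conj_conj]
  ring

/-- A power series with positive coefficients in the Hermitian inner product is a strictly positive
definite kernel. -/
theorem eq_zero_of_kernel_mul_eq_zero {N m : ℕ} {a : ℕ → ℝ} (ha : ∀ k, 0 < a k) {κ : ℂ → ℂ}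
    {p : Fin m → Fin N → ℂ}
    (hκ : ∀ i j, HasSum (fun k => (a k : ℂ) * (∑ l, p i l * conj (p j l)) ^ k)
      (κ (∑ l, p i l * conj (p j l)))) {l : Fin N} (hinj : Function.Injective fun i => p i l)
    {v : Fin m → ℂ} (hv : ∀ i, ∑ j, κ (∑ l, p i l * conj (p j l)) * v j = 0) : v = 0 := by
  have h1 : HasSum (fun k => ∑ i, conj (v i) *
      ∑ j, (a k : ℂ) * (∑ l, p i l * conj (p j l)) ^ k * v j) 0 := by
    have := hasSum_sum (s := Finset.univ) fun i _ => (hasSum_sum (s := Finset.univ)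
      fun j _ => (hκ i j).mul_right (v j)).mul_left (conj (v i))
    simpa [hv] using this
  have h2 : HasSum (fun k => a k *
      ∑ t : Fin k → Fin N, ‖∑ i, conj (v i) * ∏ s, p i (t s)‖ ^ 2) 0 := by
    rw [← Complex.hasSum_ofReal, Complex.ofReal_zero]
    convert h1 using 2 with k
    rw [Complex.ofReal_mul, ← sum_conj_mul_pow_mul, Finset.mul_sum]
    refine Finset.sum_congr rfl fun i _ => ?_
    rw [mul_left_comm, Finset.mul_sum]
    simp only [mul_assoc]
  -- A vanishing series of nonnegative terms vanishes degree by degree, and because `a k > 0` so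
  -- does every square in degree `k`.
  have h3 := (hasSum_zero_iff_of_nonneg fun k => mul_nonneg (ha k).le
    (Finset.sum_nonneg fun _ _ => by positivity)).1 h2
  have h4 : (fun i => conj (v i)) = 0 := by
    -- The constant multi-index `l` gives `∑ conj (v i) (p i l)^k = 0` for every `k`: a Vandermonde
    -- system with distinct nodes.
    refine Matrix.eq_zero_of_forall_pow_sum_mul_pow_eq_zero hinj fun k => ?_
    have := congrFun h3 k
    simp only [Pi.zero_apply, mul_eq_zero, (ha k).ne', false_or] at this
    have := (Finset.sum_eq_zero_iff_of_nonneg fun _ _ => by positivity).1 this (fun _ => l)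
      (Finset.mem_univ _)
    simpa using this
  ext i
  simpa using congrFun h4 i

end KahlerGeometry

namespace KahlerGeometry

open Complex ComplexConjugate Metric

/-! ### The exponential of a multiple of the potential -/

/-- The holomorphic function `ψ` such that `ψ(∑ |z_j|²)` is the potential of `F(N, b)`. -/
noncomputable def potentialFun (b : ℝ) (s : ℂ) : ℂ :=
  if b = 0 then s else 1 / b * log (1 + b * s)

/-- `exp (c ψ(s))`, where `ψ(∑ |z_j|²)` is the potential of `F(N, b)`. -/
noncomputable def potentialExp (b c : ℝ) (s : ℂ) : ℂ :=
  exp (c * potentialFun b s)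

theorem one_add_mem_slitPlane {b : ℝ} (hb : b ≤ 0) {s : ℂ} (hs : -b * ‖s‖ < 1) :
    1 + b * s ∈ slitPlane := by
  refine mem_slitPlane_of_norm_lt_one ?_
  rwa [norm_mul, Complex.norm_real, Real.norm_of_nonpos hb]

theorem hasDerivAt_potentialFun {b : ℝ} (hb : b ≤ 0) {s : ℂ} (hs : -b * ‖s‖ < 1) :
    HasDerivAt (potentialFun b) (1 / (1 + b * s)) s := by
  rcases hb.eq_or_lt with rfl | hb'
  · have : potentialFun 0 = id := by funext; simp [potentialFun]
    simpa [this] using hasDerivAt_id s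
  · have : potentialFun b = fun s => 1 / b * log (1 + b * s) := by
      funext; simp [potentialFun, hb'.ne]
    rw [this]
    have hb0 : (b : ℂ) ≠ 0 := by exact_mod_cast hb'.ne
    have := ((((hasDerivAt_id s).const_mul (b : ℂ)).const_add 1).clog
      (one_add_mem_slitPlane hb hs)).const_mul (1 / b : ℂ)
    convert! this using 1
    simp
    field_simp

theorem potentialFun_norm_sq {N : ℕ} {b : ℝ} {u : Cn N} (hu : u ∈ spaceFormDomain N b) :
    potentialFun b (∑ l, u l * conj (u l)) = spaceFormPotential N b u := by
  have h1 : ∑ l, u l * conj (u l) = ((‖u‖ ^ 2 : ℝ) : ℂ) := by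
    rw [EuclideanSpace.norm_sq_eq]
    push_cast
    simp [Complex.mul_conj']
  have hu' : 0 < 1 + b * ‖u‖ ^ 2 := hu
  rw [h1, potentialFun, spaceFormPotential]
  split_ifs
  · rfl
  · push_cast
    rw [Complex.ofReal_log hu'.le]
    push_cast
    rfl

/-- For `b = 0` this is the series of `e^(cs)`. For `b < 0` the function is `(1 - |b|s)^(-p)` with
`p = c/|b|`, whose binomial coefficients `p(p+1)⋯(p+k-1)/k!` are positive exactly because `c > 0`.
-/
theorem exists_hasSum_potentialExp {b c : ℝ} (hb : b ≤ 0) (hc : 0 < c) :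
    ∃ a : ℕ → ℝ, (∀ k, 0 < a k) ∧ ∀ s : ℂ, -b * ‖s‖ < 1 →
      HasSum (fun k => (a k : ℂ) * s ^ k) (potentialExp b c s) := by
  rcases hb.eq_or_lt with rfl | hb
  · refine ⟨fun k => c ^ k / k.factorial, fun k => by positivity, fun s _ => ?_⟩
    have := NormedSpace.expSeries_div_hasSum_exp (c * s : ℂ)
    rw [← Complex.exp_eq_exp_ℂ] at this
    simp only [potentialExp, potentialFun, if_true]
    convert! this using 2 with k
    push_cast
    ring
  · obtain ⟨p, hp⟩ : ∃ p : ℝ, p = c / (-b) := ⟨_, rfl⟩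
    have hp0 : 0 < p := hp ▸ div_pos hc (neg_pos.2 hb)
    refine ⟨fun k => Ring.choose (p + k - 1) k * (-b) ^ k, fun k => ?_, fun s hs => ?_⟩
    · refine mul_pos ?_ (pow_pos (neg_pos.2 hb) k)
      rw [← Ring.multichoose_eq]
      have h1 := Ring.factorial_nsmul_multichoose_eq_ascPochhammer p k
      rw [Polynomial.ascPochhammer_smeval_eq_eval] at h1
      have h2 := ascPochhammer_pos k p hp0
      rw [← h1, nsmul_eq_mul] at h2
      exact pos_of_mul_pos_right h2 (by positivity)
    · have h1 := (one_div_one_sub_cpow_hasFPowerSeriesOnBall_zero (p : ℂ)).hasSum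
        (y := ((-b : ℝ) : ℂ) * s) (by
          rw [Metric.mem_eball, edist_zero_right, ← ofReal_norm, norm_mul,
            Complex.norm_of_nonneg (neg_pos.2 hb).le]
          simpa using hs)
      have hne : (1 : ℂ) + b * s ≠ 0 := by
        intro h
        have : ‖(b : ℂ) * s‖ = 1 := by
          rw [show (b : ℂ) * s = -1 by linear_combination h]; simp
        rw [norm_mul, Complex.norm_real, Real.norm_of_nonpos hb.le] at this
        linarith
      have h2 : potentialExp b c s = 1 / (1 - (0 + ((-b : ℝ) : ℂ) * s)) ^ (p : ℂ) := by
        rw [show (1 : ℂ) - (0 + ((-b : ℝ) : ℂ) * s) = 1 + b * s by push_cast; ring,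
          cpow_def_of_ne_zero hne, one_div, ← exp_neg, potentialExp,
          potentialFun, if_neg hb.ne, hp]
        congr 1
        have : (b : ℂ) ≠ 0 := by exact_mod_cast hb.ne
        push_cast
        field_simp
      rw [h2]
      convert! h1 using 2 with k
      have h3 : ((Ring.choose (p + k - 1) k : ℝ) : ℂ) = Ring.choose ((p : ℂ) + k - 1) k := by
        rw [Complex.ofReal_choose]; push_cast; rfl
      simp [FormalMultilinearSeries.ofScalars, h3]
      ring

/-- Cauchy–Schwarz. It keeps the polarized argument, at two different points, inside the disc where
the power series and the logarithm are controlled. -/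
theorem norm_sum_mul_conj_lt {N : ℕ} {b : ℝ} (hb : b ≤ 0) {u v : Cn N}
    (hu : u ∈ spaceFormDomain N b) (hv : v ∈ spaceFormDomain N b) :
    -b * ‖∑ l, u l * conj (v l)‖ < 1 := by
  have h1 : ‖∑ l, u l * conj (v l)‖ ≤ ‖v‖ * ‖u‖ := by
    have := norm_inner_le_norm (𝕜 := ℂ) v u
    rwa [PiLp.inner_apply] at this
  have hu' : 0 < 1 + b * ‖u‖ ^ 2 := hu
  have hv' : 0 < 1 + b * ‖v‖ ^ 2 := hv
  calc -b * ‖∑ l, u l * conj (v l)‖ ≤ -b * (‖v‖ * ‖u‖) :=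
        mul_le_mul_of_nonneg_left h1 (neg_nonneg.2 hb)
    _ < 1 := by nlinarith [sq_nonneg (‖u‖ - ‖v‖)]

/-- The kernel `exp (c ψ(⟨f(z), f(w)⟩))` has infinite rank for `c > 0` and nonconstant `f`. -/
theorem not_isFiniteRankKernel_potentialExp {N : ℕ} {b c : ℝ} (hb : b ≤ 0) (hc : 0 < c)
    {S : Set ℂ} (hS : IsPreconnected S) {f : ℂ → Cn N} (hf : ContinuousOn f S)
    (hmem : ∀ z ∈ S, f z ∈ spaceFormDomain N b) {z₀ z₁ : ℂ} (h₀ : z₀ ∈ S) (h₁ : z₁ ∈ S)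
    (hne : f z₀ ≠ f z₁) {K : ℂ → ℂ → ℂ} (hK : IsFiniteRankKernel K) :
    ¬ ∀ z ∈ S, ∀ w ∈ S, K z w = potentialExp b c (∑ l, f z l * conj (f w l)) := by
  intro hKeq
  obtain ⟨l, hl⟩ : ∃ l, f z₀ l ≠ f z₁ l := by
    by_contra! h
    exact hne (PiLp.ext h)
  have hcont : ContinuousOn (fun z => f z l) S := by fun_prop
  -- A connected set with two points is infinite, so arbitrarily many points with distinct `l`-th
  -- coordinates are available.
  have hinf : ((fun z => f z l) '' S).Infinite :=
    (hS.image _ hcont).infinite_of_nontrivial ⟨_, ⟨z₀, h₀, rfl⟩, _, ⟨z₁, h₁, rfl⟩, hl⟩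
  obtain ⟨m, hm⟩ := hK.exists_sum_mul_eq_zero
  choose z hzS hz using fun i : Fin m => (hinf.natEmbedding _ i).2
  obtain ⟨v, hv0, hv⟩ := hm z
  obtain ⟨a, ha, hsum⟩ := exists_hasSum_potentialExp hb hc
  refine hv0 (eq_zero_of_kernel_mul_eq_zero (κ := potentialExp b c) ha
    (p := fun i => f (z i)) (l := l) (fun i j => hsum _ ?_) ?_ fun i => ?_)
  · exact norm_sum_mul_conj_lt hb (hmem _ (hzS i)) (hmem _ (hzS j))
  · intro i j hij
    simp only [hz] at hij
    exact Fin.ext ((hinf.natEmbedding _).injective (Subtype.ext hij))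
  · rw [← hv (z i)]
    exact Finset.sum_congr rfl fun j _ => by rw [hKeq _ (hzS i) _ (hzS j)]

/-! ### Logarithmic derivatives of determinants -/

section Det

variable {ι κ : Type*} [Fintype ι] [DecidableEq ι] [Fintype κ]

/-- Jacobi's formula. By the chain rule the curve may be replaced by the line `A t + s A'`, and `det
(A (1 + s A⁻¹A'))` is expanded to first order in `s`. -/
theorem hasDerivAt_det {A : ℂ → Matrix ι ι ℂ} {A' : Matrix ι ι ℂ} {t : ℂ}
    (hA : ∀ i j, HasDerivAt (fun s => A s i j) (A' i j) t) (h : (A t).det ≠ 0) :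
    HasDerivAt (fun s => (A s).det) ((A t).det * ((A t)⁻¹ * A').trace) t := by
  have hdet : Differentiable ℂ fun X : ι → ι → ℂ => (Matrix.of X).det := by
    simp only [Matrix.det_apply', Matrix.of_apply]
    fun_prop
  have hA1 : HasDerivAt (fun s => (fun i j => A s i j : ι → ι → ℂ)) (fun i j => A' i j) t :=
    hasDerivAt_pi.2 fun i => hasDerivAt_pi.2 fun j => hA i j
  have h1 := (hdet fun i j => A t i j).hasFDerivAt.comp_hasDerivAt t hA1
  have hB : HasDerivAt (fun s : ℂ => (fun i j => A t i j + s * A' i j : ι → ι → ℂ))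
      (fun i j => A' i j) 0 :=
    hasDerivAt_pi.2 fun i => hasDerivAt_pi.2 fun j => by
      simpa using ((hasDerivAt_id (0 : ℂ)).mul_const (A' i j)).const_add (A t i j)
  have h2 := HasFDerivAt.comp_hasDerivAt (x := (0 : ℂ))
    (f := fun s : ℂ => (fun i j => A t i j + s * A' i j : ι → ι → ℂ))
    (by simpa using (hdet fun i j => A t i j).hasFDerivAt) hB
  have h3 : HasDerivAt (fun s : ℂ => (A t + s • A').det)
      ((A t).det * ((A t)⁻¹ * A').trace) 0 := by
    have hs : ∀ s : ℂ, (A t + s • A').det = (A t).det * (1 + ((A t)⁻¹ * A').trace * s +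
        (Matrix.det (1 + (Polynomial.X : Polynomial ℂ) • ((A t)⁻¹ * A').map Polynomial.C)).divX.divX.eval s
          * s ^ 2) := by
      intro s
      rw [← Matrix.det_one_add_smul, ← Matrix.det_mul, mul_add, mul_one, Matrix.mul_smul,
        ← mul_assoc, Matrix.mul_nonsing_inv _ (isUnit_iff_ne_zero.2 h), one_mul]
    simp_rw [hs]
    have := ((((hasDerivAt_id (0 : ℂ)).const_mul ((A t)⁻¹ * A').trace).const_add 1).add
      ((Polynomial.hasDerivAt (Matrix.det (1 + (Polynomial.X : Polynomial ℂ) •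
        ((A t)⁻¹ * A').map Polynomial.C)).divX.divX 0).mul
        ((hasDerivAt_id (0 : ℂ)).pow 2))).const_mul (A t).det
    convert! this using 1
    simp
  have h4 := h2.unique (f := fun s : ℂ => (A t + s • A').det) h3
  rw [h4] at h1
  exact h1

theorem continuousAt_inv_apply {A : ℂ → Matrix ι ι ℂ} {t : ℂ}
    (hA : ContinuousAt A t) (h : (A t).det ≠ 0) :
    ContinuousAt (fun s => (A s)⁻¹) t := by
  simp only [Matrix.inv_def, Ring.inverse_eq_inv']
  have h1 : ContinuousAt (fun s => (A s).det) t :=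
    (continuous_id.matrix_det.continuousAt (x := A t)).comp hA
  have h2 : ContinuousAt (fun s => (A s).adjugate) t :=
    (continuous_id.matrix_adjugate.continuousAt (x := A t)).comp hA
  exact (h1.inv₀ h).smul h2

/-- The mixed logarithmic derivative of `det (L(z) R(w))` at the origin, in terms of the components
`N`, `M` of `L'(0)`, `R'(0)` normal to `R(0)`, `L(0)`. -/
theorem trace_inv_mul_normal_eq {L : ℂ → Matrix ι κ ℂ} {R : ℂ → Matrix κ ι ℂ}
    {N : Matrix ι κ ℂ} {M : Matrix κ ι ℂ} {Γ Δ : Matrix ι ι ℂ} {E θw : ℂ → ℂ} {θ : ℂ → ℂ → ℂ}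
    {θzw : ℂ}
    (hL : ∀ i j, HasDerivAt (fun z => L z i j) ((Γ * L 0 + N) i j) 0)
    (hR : ∀ i j, HasDerivAt (fun z => R z i j) ((R 0 * Δ + M) i j) 0)
    (hM : L 0 * M = 0) (hdet : (L 0 * R 0).det ≠ 0)
    (hP : ∀ᶠ z in nhds 0, ∀ᶠ w in nhds 0, (L z * R w).det = E z * exp (θ z w))
    (hθ : ∀ᶠ z in nhds 0, HasDerivAt (θ z) (θw z) 0) (hθ' : HasDerivAt θw θzw 0) :
    ((L 0 * R 0)⁻¹ * (N * M)).trace = θzw := by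
  have hLc : ContinuousAt L 0 :=
    continuousAt_pi.2 fun i => continuousAt_pi.2 fun j => (hL i j).continuousAt
  have hAc : ContinuousAt (fun z => L z * R 0) 0 := by
    have : Continuous fun X : Matrix ι κ ℂ => X * R 0 := by fun_prop
    exact this.continuousAt.comp hLc
  have hne : ∀ᶠ z in nhds 0, (L z * R 0).det ≠ 0 :=
    (ContinuousAt.comp (g := fun X : Matrix ι ι ℂ => X.det) (f := fun z => L z * R 0)
      continuous_id.matrix_det.continuousAt hAc).eventually_ne hdet
  -- Logarithmic differentiation in `w` at `0` removes the factor `E z`; the part `R 0 * Δ` of the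
  -- derivative contributes the constant `Δ.trace`.
  have h1 : ∀ᶠ z in nhds 0, Δ.trace + ((L z * R 0)⁻¹ * (L z * M)).trace = θw z := by
    filter_upwards [hP, hθ, hne] with z hz hzθ hz0
    have hd : HasDerivAt (fun w => (L z * R w).det) _ 0 :=
      hasDerivAt_det (A := fun w => L z * R w) (A' := L z * (R 0 * Δ + M)) (fun i j => by
        simp only [Matrix.mul_apply]
        have := HasDerivAt.fun_sum (u := Finset.univ) fun k _ => (hR k j).const_mul (L z i k)
        simpa [Matrix.mul_apply] using this) hz0
    have hd' := (hzθ.cexp.const_mul (E z)).congr_of_eventuallyEq hz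
    have := hd.unique hd'
    rw [← mul_assoc (E z), ← hz.self_of_nhds] at this
    have := mul_left_cancel₀ hz0 this
    rw [← this, Matrix.mul_add, Matrix.mul_add, Matrix.trace_add, ← Matrix.mul_assoc (L z),
      ← Matrix.mul_assoc _ (L z * R 0), Matrix.nonsing_inv_mul _ (isUnit_iff_ne_zero.2 hz0), one_mul]
  have hB : HasDerivAt (fun z => ((L z * R 0)⁻¹ * (L z * M)).trace)
      ((L 0 * R 0)⁻¹ * (N * M)).trace 0 := by
    simp only [Matrix.trace, Matrix.diag, Matrix.mul_apply (M := (L _ * R 0)⁻¹)]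
    refine HasDerivAt.fun_sum fun i _ => HasDerivAt.fun_sum fun j _ => ?_
    have hinv : ContinuousAt (fun z => (L z * R 0)⁻¹ i j) 0 := by
      have := continuousAt_inv_apply hAc hdet
      exact continuousAt_pi.1 (continuousAt_pi.1 this i) j
    have hLM : HasDerivAt (fun z => (L z * M) j i) ((N * M) j i) 0 := by
      have : N * M = (Γ * L 0 + N) * M := by rw [Matrix.add_mul, Matrix.mul_assoc, hM, Matrix.mul_zero, zero_add]
      rw [this]
      simp only [Matrix.mul_apply (N := M)]
      exact HasDerivAt.fun_sum fun k _ => (hL j k).mul_const _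
    -- As `L 0 * M = 0`, the product rule needs only continuity of the inverse, not its derivative.
    rw [hasDerivAt_iff_tendsto_slope] at hLM ⊢
    have h0 : (L 0 * M) j i = 0 := by rw [hM]; rfl
    refine ((hinv.tendsto.mono_left nhdsWithin_le_nhds).mul hLM).congr fun z => ?_
    simp only [slope, vsub_eq_sub, h0, mul_zero, smul_eq_mul]
    ring
  exact ((hB.const_add Δ.trace).congr_of_eventuallyEq
    (h1.mono fun _ h => h.symm)).unique hθ'

end Det

end KahlerGeometry

namespace KahlerGeometry

open Complex ComplexConjugate Metric
open scoped Laplacian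

/-! ### The complex Hessian and the Laplacian -/

section Hessian

variable {m : ℕ}

/-- The sesquilinear form associated with a real bilinear form. -/
noncomputable def sesqOfBilin (B : Cn m →L[ℝ] Cn m →L[ℝ] ℝ) : Cn m →ₗ[ℂ] Cn m →ₗ⋆[ℂ] ℂ :=
  have smul_eq : ∀ (c : ℂ) (a : Cn m), c • a = c.re • a + c.im • (I • a) := fun c a => by
    rw [← Complex.coe_smul, ← Complex.coe_smul, smul_smul, ← add_smul, Complex.re_add_im]
  LinearMap.mk₂'ₛₗ (RingHom.id ℂ) (starRingEnd ℂ)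
    (fun a b => (B a b + B (I • a) (I • b) : ℝ) + I * (B a (I • b) - B (I • a) b : ℝ))
    (fun a a' b => by simp only [smul_add, map_add, add_apply]; push_cast; ring)
    (fun c a b => by
      have h : I • c • a = c.re • (I • a) - c.im • a := by
        rw [smul_eq c a, smul_add, smul_comm I c.re a, smul_comm I c.im (I • a), smul_smul, I_mul_I]
        simp [sub_eq_add_neg]
      rw [h, smul_eq c a]
      simp only [map_add, map_sub, map_smul, add_apply,
        sub_apply, smul_apply, smul_eq_mul, RingHom.id_apply]
      apply Complex.ext <;> simp <;> ring)
    (fun a b b' => by simp only [smul_add, map_add]; push_cast; ring)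
    (fun c a b => by
      have h : I • c • b = c.re • (I • b) - c.im • b := by
        rw [smul_eq c b, smul_add, smul_comm I c.re b, smul_comm I c.im (I • b), smul_smul, I_mul_I]
        simp [sub_eq_add_neg]
      rw [h, smul_eq c b]
      simp only [map_add, map_sub, map_smul, smul_eq_mul]
      apply Complex.ext <;> simp <;> ring)

theorem sesqOfBilin_apply (B : Cn m →L[ℝ] Cn m →L[ℝ] ℝ) (a b : Cn m) :
    sesqOfBilin B a b
      = (B a b + B (I • a) (I • b) : ℝ) + I * (B a (I • b) - B (I • a) b : ℝ) := rfl

theorem I_smul_single (j : Fin m) :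
    I • (EuclideanSpace.single j 1 : Cn m) = EuclideanSpace.single j I := by
  ext i
  by_cases h : i = j <;> simp [h]

/-- Passing from the real Hessian to the sesquilinear form reduces evaluation along complex
directions to linear algebra. -/
theorem complexHessian_eq {u : Cn m → ℝ} {x : Cn m} (hu : ContDiffAt ℝ 2 u x) (j k : Fin m) :
    complexHessian u x j k = 1 / 4 * sesqOfBilin (fderiv ℝ (fderiv ℝ u) x)
      (EuclideanSpace.single j 1) (EuclideanSpace.single k 1) := by
  have h1 : ∀ᶠ y in nhds x, ∀ d, fderiv ℝ (fun w => (u w : ℂ)) y d = (fderiv ℝ u y d : ℂ) := by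
    filter_upwards [hu.eventually (by simp)] with y hy d
    have := Complex.ofRealCLM.hasFDerivAt.comp y (hy.differentiableAt (by simp)).hasFDerivAt
    exact DFunLike.congr_fun this.fderiv d
  have hd : HasFDerivAt (fderiv ℝ u) (fderiv ℝ (fderiv ℝ u) x) x :=
    ((hu.fderiv_right (m := 1) (by norm_num)).differentiableAt (by simp)).hasFDerivAt
  have h2 : ∀ d : Cn m, HasFDerivAt (fun y => (fderiv ℝ u y d : ℂ))
      (Complex.ofRealCLM.comp ((fderiv ℝ (fderiv ℝ u) x).flip d)) x := fun d =>
    Complex.ofRealCLM.hasFDerivAt.comp x (by simpa using hd.clm_apply (hasFDerivAt_const d x))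
  have h3 : (dzbar (fun w => (u w : ℂ)) k) =ᶠ[nhds x] fun y => (1 / 2 : ℂ) *
      ((fderiv ℝ u y (EuclideanSpace.single k 1) : ℂ)
        + I * (fderiv ℝ u y (EuclideanSpace.single k I) : ℂ)) := by
    filter_upwards [h1] with y hy
    simp only [dzbar, hy]
  have h4 := (((h2 (EuclideanSpace.single k 1)).add
    ((h2 (EuclideanSpace.single k I)).const_mul I)).const_mul (1 / 2 : ℂ)).congr_of_eventuallyEq h3
  rw [complexHessian, dz, h4.fderiv, sesqOfBilin_apply, I_smul_single, I_smul_single]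
  simp
  linear_combination (-(1 / 4 : ℂ) * (fderiv ℝ (fderiv ℝ u) x (EuclideanSpace.single j I)
    (EuclideanSpace.single k I) : ℂ)) * I_mul_I

theorem eq_sum_smul_single (a : Cn m) :
    a = ∑ j, a j • (EuclideanSpace.single j 1 : Cn m) := by
  ext i
  simp [Pi.single_apply]

theorem sesq_sum (S : Cn m →ₗ[ℂ] Cn m →ₗ⋆[ℂ] ℂ) (a b : Cn m) :
    S a b = ∑ j, ∑ k, S (EuclideanSpace.single j 1) (EuclideanSpace.single k 1)
      * a j * conj (b k) := by
  conv_lhs => rw [eq_sum_smul_single a, eq_sum_smul_single b]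
  simp only [map_sum, LinearMap.sum_apply, map_smul, LinearMap.smul_apply, LinearMap.map_smulₛₗ,
    smul_eq_mul, Finset.mul_sum]
  rw [Finset.sum_comm]
  exact Finset.sum_congr rfl fun j _ => Finset.sum_congr rfl fun k _ => by ring

theorem sum_complexHessian_re {u : Cn m → ℝ} {x : Cn m} (hu : ContDiffAt ℝ 2 u x) (a : Cn m) :
    (∑ j, ∑ k, complexHessian u x j k * a j * conj (a k)).re
      = 1 / 4 * (fderiv ℝ (fderiv ℝ u) x a a + fderiv ℝ (fderiv ℝ u) x (I • a) (I • a)) := by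
  have : ∑ j, ∑ k, complexHessian u x j k * a j * conj (a k)
      = 1 / 4 * sesqOfBilin (fderiv ℝ (fderiv ℝ u) x) a a := by
    rw [sesq_sum, Finset.mul_sum]
    refine Finset.sum_congr rfl fun j _ => ?_
    rw [Finset.mul_sum]
    refine Finset.sum_congr rfl fun k _ => ?_
    rw [complexHessian_eq hu]
    ring
  rw [this, sesqOfBilin_apply]
  rw [show (1 / 4 : ℂ) = ((1 / 4 : ℝ) : ℂ) by norm_num, Complex.re_ofReal_mul]
  simp

/-- The Laplacian of a function along a holomorphic curve is four times its complex Hessian in the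
direction of the curve. -/
theorem laplacian_comp {u : Cn m → ℝ} {γ : ℂ → Cn m} {ζ : ℂ} (hγ : AnalyticAt ℂ γ ζ)
    (hu : ContDiffAt ℝ 2 u (γ ζ)) :
    Δ (u ∘ γ) ζ = 4 * (∑ j, ∑ k, complexHessian u (γ ζ) j k * deriv γ ζ j
      * conj (deriv γ ζ k)).re := by
  have hev : ∀ᶠ z in nhds ζ, ∀ v, fderiv ℝ (u ∘ γ) z v = fderiv ℝ u (γ z) (v • deriv γ z) := by
    filter_upwards [hγ.continuousAt.eventually (hu.eventually (by simp)),
      hγ.eventually_analyticAt] with z hz hγz v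
    have h1 : HasFDerivAt γ ((ContinuousLinearMap.toSpanSingleton ℂ (deriv γ z)).restrictScalars ℝ) z :=
      hγz.differentiableAt.hasDerivAt.hasFDerivAt.restrictScalars ℝ
    rw [((hz.differentiableAt (by simp)).hasFDerivAt.comp z h1).fderiv]
    simp
  have hγ' : HasFDerivAt (deriv γ)
      ((ContinuousLinearMap.toSpanSingleton ℂ (deriv (deriv γ) ζ)).restrictScalars ℝ) ζ :=
    hγ.deriv.differentiableAt.hasDerivAt.hasFDerivAt.restrictScalars ℝ
  have h1 : HasFDerivAt γ ((ContinuousLinearMap.toSpanSingleton ℂ (deriv γ ζ)).restrictScalars ℝ) ζ :=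
    hγ.differentiableAt.hasDerivAt.hasFDerivAt.restrictScalars ℝ
  have hd : HasFDerivAt (fderiv ℝ u) (fderiv ℝ (fderiv ℝ u) (γ ζ)) (γ ζ) :=
    ((hu.fderiv_right (m := 1) (by norm_num)).differentiableAt (by simp)).hasFDerivAt
  have hcomp : ContDiffAt ℝ 2 (u ∘ γ) ζ := hu.comp ζ (hγ.contDiffAt.restrict_scalars ℝ)
  have hd2 : HasFDerivAt (fderiv ℝ (u ∘ γ)) (fderiv ℝ (fderiv ℝ (u ∘ γ)) ζ) ζ :=
    ((hcomp.fderiv_right (m := 1) (by norm_num)).differentiableAt (by simp)).hasFDerivAt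
  -- The last term carries `γ''` multiplied by `v²`; it cancels between `v = 1` and `v = I`, the two
  -- directions summed in the Laplacian.
  have h2 : ∀ v : ℂ, fderiv ℝ (fderiv ℝ (u ∘ γ)) ζ v v
      = fderiv ℝ (fderiv ℝ u) (γ ζ) (v • deriv γ ζ) (v • deriv γ ζ)
        + fderiv ℝ u (γ ζ) ((v * v) • deriv (deriv γ) ζ) := by
    intro v
    have ha := hd2.clm_apply (hasFDerivAt_const v ζ)
    have hb := (hd.comp ζ h1).clm_apply (hγ'.const_smul v)
    have hc := ha.unique (hb.congr_of_eventuallyEq (hev.mono fun z hz => hz v))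
    have := DFunLike.congr_fun hc v
    simp at this
    rw [this, smul_smul]
    ring
  rw [InnerProductSpace.laplacian_eq_iteratedFDeriv_complexPlane, sum_complexHessian_re hu]
  simp only [iteratedFDeriv_two_apply, Matrix.cons_val_zero, Matrix.cons_val_one, h2]
  simp
  ring

end Hessian

end KahlerGeometry

namespace KahlerGeometry

open Complex ComplexConjugate Metric

/-! ### The metric and the connection of the space forms -/

section SpaceForm

variable {N : ℕ} {b : ℝ}

theorem isOpen_spaceFormDomain : IsOpen (spaceFormDomain N b) :=
  isOpen_lt continuous_const (by fun_prop)

theorem inner_single_one (z : Cn N) (j : Fin N) :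
    inner ℝ z (EuclideanSpace.single j 1) = (z j).re := by
  rw [PiLp.inner_apply, Finset.sum_eq_single j] <;> simp +contextual [Complex.inner]

theorem inner_single_I (z : Cn N) (j : Fin N) :
    inner ℝ z (EuclideanSpace.single j I) = (z j).im := by
  rw [PiLp.inner_apply, Finset.sum_eq_single j] <;> simp +contextual [Complex.inner]

theorem inner_real_eq_re (z w : Cn N) : inner ℝ z w = (inner ℂ z w).re := by
  simp [PiLp.inner_apply, Complex.inner, mul_comm]

theorem hasFDerivAt_spaceFormPotential {z : Cn N} (hz : z ∈ spaceFormDomain N b) :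
    HasFDerivAt (spaceFormPotential N b)
      ((2 / (1 + b * ‖z‖ ^ 2)) • (innerSL ℝ z)) z := by
  have h1 : HasFDerivAt (fun w : Cn N => ‖w‖ ^ 2) (2 • innerSL ℝ z) z :=
    (hasStrictFDerivAt_norm_sq z).hasFDerivAt
  have hz' : 0 < 1 + b * ‖z‖ ^ 2 := hz
  by_cases hb : b = 0
  · subst hb
    have : spaceFormPotential N 0 = fun w => ‖w‖ ^ 2 := by
      funext w; simp [spaceFormPotential]
    rw [this]
    convert h1 using 1
    ext d
    simp
  · have : spaceFormPotential N b = fun w => (1 / b) * Real.log (1 + b * ‖w‖ ^ 2) := by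
      funext w; simp [spaceFormPotential, hb]
    rw [this]
    convert! (((h1.const_mul b).const_add 1).log hz'.ne').const_mul (1 / b) using 1
    ext d
    simp
    field_simp

theorem contDiffAt_spaceFormPotential {z : Cn N} (hz : z ∈ spaceFormDomain N b) :
    ContDiffAt ℝ 2 (spaceFormPotential N b) z := by
  have hz' : 0 < 1 + b * ‖z‖ ^ 2 := hz
  have h1 : ContDiffAt ℝ 2 (fun w : Cn N => ‖w‖ ^ 2) z := (contDiff_norm_sq ℝ).contDiffAt
  by_cases hb : b = 0
  · have : spaceFormPotential N b = fun w => ‖w‖ ^ 2 := by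
      funext w; simp [spaceFormPotential, hb]
    rwa [this]
  · have : spaceFormPotential N b = fun w => (1 / b) * Real.log (1 + b * ‖w‖ ^ 2) := by
      funext w; simp [spaceFormPotential, hb]
    rw [this]
    exact contDiffAt_const.mul ((contDiffAt_const.add (contDiffAt_const.mul h1)).log hz'.ne')

/-- Valid also for `b = 0`, where both sides vanish. It lets both kinds of space form share the
constant `c` of the main argument. -/
theorem log_eq_mul_spaceFormPotential (z : Cn N) :
    Real.log (1 + b * ‖z‖ ^ 2) = b * spaceFormPotential N b z := by
  by_cases hb : b = 0 <;> simp [spaceFormPotential, hb]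

theorem dzbar_spaceFormPotential {z : Cn N} (hz : z ∈ spaceFormDomain N b) (k : Fin N) :
    dzbar (fun w => (spaceFormPotential N b w : ℂ)) k z = z k / (1 + b * ‖z‖ ^ 2 : ℝ) := by
  have h := Complex.ofRealCLM.hasFDerivAt.comp z (hasFDerivAt_spaceFormPotential hz)
  have h' : fderiv ℝ (fun w => (spaceFormPotential N b w : ℂ)) z = _ := h.fderiv
  rw [dzbar, h']
  simp only [ContinuousLinearMap.comp_apply, smul_apply, innerSL_apply_apply, inner_single_one,
    inner_single_I, Complex.ofRealCLM_apply, smul_eq_mul]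
  have hz' : (1 + b * ‖z‖ ^ 2 : ℝ) ≠ 0 := ne_of_gt hz
  have hz'' : ((1 + b * ‖z‖ ^ 2 : ℝ) : ℂ) ≠ 0 := by exact_mod_cast hz'
  rw [Complex.ofReal_mul, Complex.ofReal_mul, Complex.ofReal_div]
  conv_rhs => rw [← Complex.re_add_im (z k)]
  field_simp
  push_cast
  ring

theorem hasFDerivAt_inv_one_add {z : Cn N} (hz : z ∈ spaceFormDomain N b) :
    HasFDerivAt (fun y : Cn N => (((1 + b * ‖y‖ ^ 2)⁻¹ : ℝ) : ℂ))
      (Complex.ofRealCLM.comp ((-((1 + b * ‖z‖ ^ 2) ^ 2)⁻¹) • b • 2 • innerSL ℝ z)) z :=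
  Complex.ofRealCLM.hasFDerivAt.comp z
    ((hasDerivAt_inv (ne_of_gt hz)).comp_hasFDerivAt z
      (((hasStrictFDerivAt_norm_sq z).hasFDerivAt.const_mul b).const_add 1))

theorem complexHessian_spaceFormPotential {z : Cn N} (hz : z ∈ spaceFormDomain N b)
    (j k : Fin N) :
    complexHessian (spaceFormPotential N b) z j k
      = (if j = k then 1 else 0) / (1 + b * ‖z‖ ^ 2 : ℝ)
        - b * conj (z j) * z k / (1 + b * ‖z‖ ^ 2 : ℝ) ^ 2 := by
  have h1 : dzbar (fun w => (spaceFormPotential N b w : ℂ)) k =ᶠ[nhds z]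
      fun w => w k * (((1 + b * ‖w‖ ^ 2)⁻¹ : ℝ) : ℂ) := by
    filter_upwards [isOpen_spaceFormDomain.mem_nhds hz] with w hw
    rw [dzbar_spaceFormPotential hw, div_eq_mul_inv, Complex.ofReal_inv]
  have hp : HasFDerivAt (fun w : Cn N => w k)
      ((EuclideanSpace.proj (𝕜 := ℂ) k).restrictScalars ℝ) z :=
    ((EuclideanSpace.proj (𝕜 := ℂ) k).restrictScalars ℝ).hasFDerivAt
  have hd := (hp.mul (hasFDerivAt_inv_one_add hz)).congr_of_eventuallyEq h1
  have hz' : (1 + b * ‖z‖ ^ 2 : ℝ) ≠ 0 := ne_of_gt hz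
  have hz'' : ((1 + b * ‖z‖ ^ 2 : ℝ) : ℂ) ≠ 0 := by exact_mod_cast hz'
  rw [complexHessian, dz, hd.fderiv]
  have hj : conj (z j) = (z j).re - I * (z j).im := by
    apply Complex.ext <;> simp
  have hsub : (EuclideanSpace.single j I : Cn N) k = I * if j = k then 1 else 0 := by
    by_cases h : j = k
    · subst h; simp
    · have : k ≠ j := fun h' => h h'.symm
      simp [h, this]
  have hsub1 : (EuclideanSpace.single j 1 : Cn N) k = if j = k then 1 else 0 := by
    by_cases h : j = k
    · subst h; simp
    · have : k ≠ j := fun h' => h h'.symm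
      simp [h, this]
  simp only [add_apply, ContinuousLinearMap.comp_apply, smul_apply, innerSL_apply_apply,
    inner_single_one, inner_single_I, Complex.ofRealCLM_apply, smul_eq_mul,
    ContinuousLinearMap.coe_restrictScalars', PiLp.proj_apply, hsub, hsub1]
  rw [hj]
  generalize hQ : (1 + b * ‖z‖ ^ 2 : ℝ) = Q at *
  push_cast
  field_simp
  generalize (if j = k then (1 : ℂ) else 0) = t
  linear_combination (-(t * Q)) * I_mul_I

theorem inner_complex_eq_sum (u v : Cn N) : inner ℂ v u = ∑ j, u j * conj (v j) := by
  simp [PiLp.inner_apply]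

theorem spaceFormHermitian_eq {z : Cn N} (hz : z ∈ spaceFormDomain N b) (u v : Cn N) :
    spaceFormHermitian N b z u v = inner ℂ v u / (1 + b * ‖z‖ ^ 2 : ℝ)
      - b * inner ℂ z u * inner ℂ v z / (1 + b * ‖z‖ ^ 2 : ℝ) ^ 2 := by
  simp only [spaceFormHermitian, complexHessian_spaceFormPotential hz, sub_mul,
    Finset.sum_sub_distrib]
  congr 1
  · simp only [inner_complex_eq_sum, Finset.sum_div, ite_mul, ite_div, zero_div, zero_mul,
      Finset.sum_ite_eq, Finset.mem_univ, if_true]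
    exact Finset.sum_congr rfl fun j _ => by ring
  · simp only [inner_complex_eq_sum]
    rw [mul_assoc, Finset.sum_mul_sum, Finset.mul_sum, Finset.sum_div]
    refine Finset.sum_congr rfl fun j _ => ?_
    rw [Finset.mul_sum, Finset.sum_div]
    refine Finset.sum_congr rfl fun k _ => ?_
    ring

theorem hasFDerivAt_inner_right (v z : Cn N) :
    HasFDerivAt (fun y : Cn N => inner ℂ v y) ((innerSL ℂ v).restrictScalars ℝ) z :=
  ((innerSL ℂ v).restrictScalars ℝ).hasFDerivAt

theorem hasFDerivAt_inner_left (v z : Cn N) :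
    HasFDerivAt (fun y : Cn N => inner ℂ y v)
      ((Complex.conjCLE : ℂ →L[ℝ] ℂ).comp ((innerSL ℂ v).restrictScalars ℝ)) z := by
  have := (Complex.conjCLE : ℂ →L[ℝ] ℂ).hasFDerivAt.comp z (hasFDerivAt_inner_right v z)
  refine this.congr_of_eventuallyEq (Filter.Eventually.of_forall fun y => ?_)
  simp

theorem fderiv_spaceFormMetric {z : Cn N} (hz : z ∈ spaceFormDomain N b) (u v w : Cn N) :
    fderiv ℝ (fun y => spaceFormMetric N b y v w) z u =
      (-inner ℂ w v * (2 * b * (inner ℂ z u).re) / (1 + b * ‖z‖ ^ 2 : ℝ) ^ 2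
        - b * (inner ℂ u v * inner ℂ w z + inner ℂ z v * inner ℂ w u) / (1 + b * ‖z‖ ^ 2 : ℝ) ^ 2
        + 2 * b * inner ℂ z v * inner ℂ w z * (2 * b * (inner ℂ z u).re)
          / (1 + b * ‖z‖ ^ 2 : ℝ) ^ 3 : ℂ).re := by
  have hi := hasFDerivAt_inv_one_add hz
  have hd := Complex.reCLM.hasFDerivAt.comp z ((hi.const_mul (inner ℂ w v)).sub
    ((((hasFDerivAt_inner_left v z).mul (hasFDerivAt_inner_right w z)).const_mul (b : ℂ)).mul
      (hi.mul hi)))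
  have hz' : (1 + b * ‖z‖ ^ 2 : ℝ) ≠ 0 := ne_of_gt hz
  have hz'' : ((1 + b * ‖z‖ ^ 2 : ℝ) : ℂ) ≠ 0 := by exact_mod_cast hz'
  have hd' := hd.congr_of_eventuallyEq (f₁ := fun y => spaceFormMetric N b y v w) (by
    filter_upwards [isOpen_spaceFormDomain.mem_nhds hz] with y hy
    rw [spaceFormMetric, spaceFormHermitian_eq hy]
    simp only [Function.comp_apply, Complex.reCLM_apply, Pi.sub_apply, Pi.mul_apply]
    congr 1
    generalize 1 + b * ‖y‖ ^ 2 = q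
    push_cast
    ring)
  rw [hd'.fderiv]
  simp only [ContinuousLinearMap.comp_apply, sub_apply, add_apply, smul_apply, innerSL_apply_apply,
    Complex.reCLM_apply, Complex.ofRealCLM_apply, smul_eq_mul, inner_real_eq_re,
    ContinuousLinearMap.coe_restrictScalars', ContinuousLinearEquiv.coe_coe, Complex.conjCLE_apply,
    inner_conj_symm, Pi.mul_apply]
  congr 1
  generalize hQ : (1 + b * ‖z‖ ^ 2 : ℝ) = Q at *
  push_cast
  field_simp
  ring

/-- The Levi-Civita connection of `F(N, b)` in terms of the Hermitian metric. -/
theorem christoffel_eq {z : Cn N} (hz : z ∈ spaceFormDomain N b) (u v w : Cn N) :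
    christoffel N b z u v w = (-b / (1 + b * ‖z‖ ^ 2 : ℝ)
      * (inner ℂ z u * spaceFormHermitian N b z v w
        + inner ℂ z v * spaceFormHermitian N b z u w) : ℂ).re := by
  rw [christoffel, fderiv_spaceFormMetric hz, fderiv_spaceFormMetric hz, fderiv_spaceFormMetric hz,
    spaceFormHermitian_eq hz, spaceFormHermitian_eq hz]
  have hz' : (1 + b * ‖z‖ ^ 2 : ℝ) ≠ 0 := ne_of_gt hz
  rw [← inner_conj_symm w u, ← inner_conj_symm v u, ← inner_conj_symm w v, ← inner_conj_symm w z,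
    ← inner_conj_symm v z]
  generalize hQ : (1 + b * ‖z‖ ^ 2 : ℝ) = Q at *
  generalize inner ℂ z u = p
  generalize inner ℂ z v = q
  generalize inner ℂ z w = r
  generalize inner ℂ u v = A
  generalize inner ℂ v w = B
  generalize inner ℂ u w = C
  simp only [div_eq_mul_inv, ← Complex.ofReal_inv, ← Complex.ofReal_pow]
  have h2 : (Q ^ 2)⁻¹ = Q⁻¹ * Q⁻¹ := by rw [pow_two, mul_inv]
  have h3 : (Q ^ 3)⁻¹ = Q⁻¹ * Q⁻¹ * Q⁻¹ := by rw [pow_succ, pow_two, mul_inv, mul_inv]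
  rw [h2, h3]
  generalize Q⁻¹ = s
  simp
  ring

end SpaceForm

end KahlerGeometry

namespace KahlerGeometry

open Complex ComplexConjugate Metric

/-! ### Kähler immersions in charts -/

section Chart

variable {n N : ℕ} {M : Type*} [TopologicalSpace M] [ChartedSpace (Cn n) M]
  [IsManifold 𝓘(ℂ, Cn n) ω M] {g : KahlerMetric n M} {b : ℝ} {f : M → Cn N}
  {e : OpenPartialHomeomorph M (Cn n)}

theorem IsKahlerImmersion.analyticOnNhd (hf : IsKahlerImmersion g b f)
    (he : e ∈ atlas (Cn n) M) : AnalyticOnNhd ℂ (f ∘ e.symm) e.target := by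
  have h1 : ContMDiffOn 𝓘(ℂ, Cn n) 𝓘(ℂ, Cn N) ω (f ∘ e.symm) e.target :=
    hf.holomorphic.comp_contMDiffOn (contMDiffOn_symm_of_mem_maximalAtlas
      (IsManifold.subset_maximalAtlas he))
  exact e.open_target.analyticOn_iff_analyticOnNhd.1
    (contDiffOn_omega_iff_analyticOn e.open_target.uniqueDiffOn |>.1
      (contMDiffOn_iff_contDiffOn.1 h1))

theorem mdifferentiable_of_mem_atlas' (he : e ∈ atlas (Cn n) M) :
    e.MDifferentiable 𝓘(ℂ, Cn n) 𝓘(ℂ, Cn n) :=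
  haveI : IsManifold 𝓘(ℂ, Cn n) 1 M := IsManifold.of_le (n := ω) (by simp)
  mdifferentiable_of_mem_atlas he

theorem IsKahlerImmersion.inChart_eq (hf : IsKahlerImmersion g b f)
    (he : e ∈ atlas (Cn n) M) {x : Cn n} (hx : x ∈ e.target) (u v : Cn n) :
    inChart g.form e x u v = spaceFormHermitian N b ((f ∘ e.symm) x)
      (fderiv ℂ (f ∘ e.symm) x u) (fderiv ℂ (f ∘ e.symm) x v) := by
  have hd := (mdifferentiable_of_mem_atlas' he).mdifferentiableAt_symm hx
  have hfd : MDifferentiableAt 𝓘(ℂ, Cn n) 𝓘(ℂ, Cn N) f (e.symm x) :=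
    (hf.holomorphic (e.symm x)).mdifferentiableAt (by simp)
  have h := mfderiv_comp x hfd hd
  rw [inChart, ← hf.isometric, ← mfderiv_eq_fderiv, h]
  rfl

theorem KahlerMetric.inChart_pos (g : KahlerMetric n M) (he : e ∈ atlas (Cn n) M) {x : Cn n}
    (hx : x ∈ e.target) {u : Cn n} (hu : u ≠ 0) : 0 < (inChart g.form e x u u).re := by
  refine g.pos_def _ _ fun h => hu ?_
  have := (mdifferentiable_of_mem_atlas' he).comp_symm_deriv hx
  have h2 : mfderiv 𝓘(ℂ, Cn n) 𝓘(ℂ, Cn n) e (e.symm x)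
      (mfderiv 𝓘(ℂ, Cn n) 𝓘(ℂ, Cn n) e.symm x u) = u := DFunLike.congr_fun this u
  rw [h, map_zero] at h2
  exact h2.symm

end Chart

theorem spaceFormHermitian_smul_left {N : ℕ} {b : ℝ} (z u v : Cn N) (c : ℂ) :
    spaceFormHermitian N b z (c • u) v = c * spaceFormHermitian N b z u v := by
  simp only [spaceFormHermitian, Finset.mul_sum, PiLp.smul_apply, smul_eq_mul]
  exact Finset.sum_congr rfl fun j _ => Finset.sum_congr rfl fun k _ => by ring

/-- A criterion for total geodesy in terms of holomorphic second derivatives. -/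
theorem ambientCovariantDerivative_eq_zero {n N : ℕ} {b : ℝ} {U : Set (Cn n)} (hU : IsOpen U)
    {F : Cn n → Cn N} (hF : AnalyticOnNhd ℂ F U) (hdom : ∀ x ∈ U, F x ∈ spaceFormDomain N b)
    {x : Cn n} (hx : x ∈ U) {u v : Cn n}
    (hII : ∀ ξ, (∀ w, spaceFormHermitian N b (F x) (fderiv ℂ F x w) ξ = 0) →
      spaceFormHermitian N b (F x) (fderiv ℂ (fun y => fderiv ℂ F y v) x u) ξ = 0)
    {ξ : Cn N} (hξ : ∀ w : Cn n, spaceFormMetric N b (F x) (fderiv ℝ F x w) ξ = 0) :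
    ambientCovariantDerivative b F x u v ξ = 0 := by
  have hR : ∀ y ∈ U, fderiv ℝ F y = (fderiv ℂ F y).restrictScalars ℝ := fun y hy =>
    ((hF y hy).differentiableAt.hasFDerivAt.restrictScalars ℝ).fderiv
  have hξ' : ∀ w, spaceFormHermitian N b (F x) (fderiv ℂ F x w) ξ = 0 := by
    intro w
    have h1 := hξ w
    -- The real pairings with `w` and `I • w` give the real and imaginary parts of the Hermitian
    -- pairing, since the tangent space is complex.
    have h2 := hξ (I • w)
    simp only [hR x hx, ContinuousLinearMap.coe_restrictScalars', spaceFormMetric, map_smul,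
      spaceFormHermitian_smul_left] at h1 h2
    apply Complex.ext
    · simpa using h1
    · simpa using h2
  have h2 : fderiv ℝ (fun y => fderiv ℝ F y v) x u = fderiv ℂ (fun y => fderiv ℂ F y v) x u := by
    have h3 : (fun y => fderiv ℝ F y v) =ᶠ[nhds x] fun y => fderiv ℂ F y v := by
      filter_upwards [hU.mem_nhds hx] with y hy
      rw [hR y hy]
      rfl
    have h4 : DifferentiableAt ℂ (fun y => fderiv ℂ F y v) x :=
      (hF x hx).fderiv.differentiableAt.clm_apply (differentiableAt_const v)
    rw [h3.fderiv_eq, (h4.hasFDerivAt.restrictScalars ℝ).fderiv]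
    rfl
  -- By `christoffel_eq` the connection term is a combination of the pairings of `dF u` and `dF v`
  -- with `ξ`, which are zero.
  rw [ambientCovariantDerivative, h2, christoffel_eq (hdom x hx), spaceFormMetric, hII ξ hξ', hR x hx]
  simp [hξ']

end KahlerGeometry

namespace KahlerGeometry

open Complex ComplexConjugate Metric Matrix
open scoped ComplexOrder

/-! ### Gram matrices of Hermitian forms -/

section Gram

variable {n : ℕ}

-- Writing `G⁻¹ = BᴴB` turns the trace into that of the positive semidefinite matrix `B X Bᴴ`, and
-- `B` is invertible.
open scoped MatrixOrder Matrix.Norms.L2Operator in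
theorem trace_inv_mul_eq_zero {G X : Matrix (Fin n) (Fin n) ℂ} (hG : G.PosDef)
    (hX : X.PosSemidef) : 0 ≤ (G⁻¹ * X).trace ∧ ((G⁻¹ * X).trace = 0 → X = 0) := by
  obtain ⟨B, hB, hBG⟩ := CStarAlgebra.isStrictlyPositive_iff_eq_star_mul_self.1
    hG.inv.isStrictlyPositive
  have h1 : (G⁻¹ * X).trace = (B * X * Bᴴ).trace := by
    rw [hBG, Matrix.mul_assoc, Matrix.trace_mul_comm]
    rfl
  have h2 := hX.mul_mul_conjTranspose_same B
  refine ⟨h1 ▸ h2.trace_nonneg, fun h => ?_⟩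
  rw [h1, h2.trace_eq_zero_iff] at h
  have hu : IsUnit Bᴴ := by simpa using hB.star
  rwa [hu.mul_left_eq_zero, hB.mul_right_eq_zero] at h

variable {V : Type*} [AddCommGroup V] [Module ℂ V] (S : V →ₗ[ℂ] V →ₗ⋆[ℂ] ℂ)

/-- The Gram matrix of a family of vectors with respect to a sesquilinear form. -/
def gramMatrix (v : Fin n → V) : Matrix (Fin n) (Fin n) ℂ := Matrix.of fun i j => S (v i) (v j)

theorem star_dotProduct_gramMatrix_mulVec (v : Fin n → V) (x : Fin n → ℂ) :
    star x ⬝ᵥ (gramMatrix S v *ᵥ x) = S (∑ i, conj (x i) • v i) (∑ i, conj (x i) • v i) := by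
  simp only [dotProduct, mulVec, gramMatrix, Matrix.of_apply, map_sum, LinearMap.sum_apply,
    map_smul, LinearMap.smul_apply, LinearMap.map_smulₛₗ, smul_eq_mul, Complex.conj_conj,
    Finset.mul_sum, Pi.star_apply, Complex.star_def]
  rw [Finset.sum_comm]
  exact Finset.sum_congr rfl fun i _ => Finset.sum_congr rfl fun j _ => by ring

variable {S}

theorem posSemidef_gramMatrix (hS : ∀ u v, S v u = conj (S u v)) (hpos : ∀ u, 0 ≤ (S u u).re)
    (v : Fin n → V) : (gramMatrix S v).PosSemidef := by
  refine .of_dotProduct_mulVec_nonneg ?_ fun x => ?_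
  · ext i j
    simp [gramMatrix, ← hS]
  · rw [star_dotProduct_gramMatrix_mulVec]
    exact Complex.nonneg_iff.2 ⟨hpos _, (Complex.conj_eq_iff_im.1 (hS _ _).symm).symm⟩

theorem posDef_gramMatrix (hS : ∀ u v, S v u = conj (S u v)) {v : Fin n → V}
    (hpos : ∀ x : Fin n → ℂ, x ≠ 0 → 0 < (S (∑ i, x i • v i) (∑ i, x i • v i)).re) :
    (gramMatrix S v).PosDef := by
  refine .of_dotProduct_mulVec_pos ?_ fun x hx => ?_
  · ext i j
    simp [gramMatrix, ← hS]
  · rw [star_dotProduct_gramMatrix_mulVec]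
    refine Complex.pos_iff.2 ⟨hpos (fun i => conj (x i)) fun h => hx ?_,
      (Complex.conj_eq_iff_im.1 (hS _ _).symm).symm⟩
    ext i
    simpa using congrFun h i

/-- Orthogonal decomposition with respect to a nondegenerate frame. -/
theorem exists_normal_decomposition (e e' : Fin n → V) (hdet : IsUnit (gramMatrix S e).det) :
    ∃ (Γ : Matrix (Fin n) (Fin n) ℂ) (ν : Fin n → V),
      (∀ i, e' i = ∑ j, Γ i j • e j + ν i) ∧ ∀ i k, S (ν i) (e k) = 0 := by
  set C : Matrix (Fin n) (Fin n) ℂ := Matrix.of fun i k => S (e' i) (e k) with hC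
  -- The coefficients solve `Γ * gramMatrix S e = C`, which is orthogonality of the remainder to the
  -- frame.
  refine ⟨C * (gramMatrix S e)⁻¹, fun i => e' i - ∑ j, (C * (gramMatrix S e)⁻¹) i j • e j,
    fun i => by simp, fun i k => ?_⟩
  have h : (C * (gramMatrix S e)⁻¹ * gramMatrix S e) i k = C i k := by
    rw [Matrix.mul_assoc, Matrix.nonsing_inv_mul _ hdet, Matrix.mul_one]
  rw [Matrix.mul_apply] at h
  simp only [map_sub, map_sum, LinearMap.sub_apply, LinearMap.sum_apply, map_smul,
    LinearMap.smul_apply, smul_eq_mul]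
  rw [show S (e' i) (e k) = C i k from rfl, ← h, sub_eq_zero]
  rfl

end Gram

/-! ### The Hermitian metric as a sesquilinear form -/

section Hermitian

variable {N : ℕ} {b : ℝ}

/-- The Hermitian metric of `F(N, b)` at a point as a sesquilinear form. -/
noncomputable def hermitianForm (N : ℕ) (b : ℝ) (z : Cn N) : Cn N →ₗ[ℂ] Cn N →ₗ⋆[ℂ] ℂ :=
  LinearMap.mk₂'ₛₗ (RingHom.id ℂ) (starRingEnd ℂ) (spaceFormHermitian N b z)
    (fun u u' v => by
      simp only [spaceFormHermitian, ← Finset.sum_add_distrib, PiLp.add_apply]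
      exact Finset.sum_congr rfl fun j _ => Finset.sum_congr rfl fun k _ => by ring)
    (fun c u v => by
      rw [spaceFormHermitian_smul_left]
      rfl)
    (fun u v v' => by
      simp only [spaceFormHermitian, ← Finset.sum_add_distrib, PiLp.add_apply, map_add]
      exact Finset.sum_congr rfl fun j _ => Finset.sum_congr rfl fun k _ => by ring)
    (fun c u v => by
      simp only [spaceFormHermitian, Finset.mul_sum, PiLp.smul_apply, smul_eq_mul, map_mul]
      exact Finset.sum_congr rfl fun j _ => Finset.sum_congr rfl fun k _ => by ring)

theorem hermitianForm_apply (z u v : Cn N) :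
    hermitianForm N b z u v = spaceFormHermitian N b z u v := rfl

theorem hermitianForm_eq {z : Cn N} (hz : z ∈ spaceFormDomain N b) (u v : Cn N) :
    hermitianForm N b z u v = inner ℂ v u / (1 + b * ‖z‖ ^ 2 : ℝ)
      - b * inner ℂ z u * inner ℂ v z / (1 + b * ‖z‖ ^ 2 : ℝ) ^ 2 :=
  spaceFormHermitian_eq hz u v

theorem hermitianForm_conj {z : Cn N} (hz : z ∈ spaceFormDomain N b) (u v : Cn N) :
    hermitianForm N b z v u = conj (hermitianForm N b z u v) := by
  simp only [hermitianForm_eq hz, map_sub, map_div₀, map_mul, map_pow, Complex.conj_ofReal,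
    inner_conj_symm]
  ring

theorem hermitianForm_self_pos (hb : b ≤ 0) {z : Cn N} (hz : z ∈ spaceFormDomain N b) {u : Cn N}
    (hu : u ≠ 0) : 0 < (hermitianForm N b z u u).re := by
  have h1 : hermitianForm N b z u u = ((‖u‖ ^ 2 / (1 + b * ‖z‖ ^ 2)
      + (-b) * ‖inner ℂ z u‖ ^ 2 / (1 + b * ‖z‖ ^ 2) ^ 2 : ℝ) : ℂ) := by
    rw [hermitianForm_eq hz, inner_self_eq_norm_sq_to_K, ← inner_conj_symm u z, mul_assoc,
      Complex.mul_conj']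
    push_cast
    simp only [Complex.coe_algebraMap]
    ring
  have hz' : 0 < 1 + b * ‖z‖ ^ 2 := hz
  have hu' : 0 < ‖u‖ := norm_pos_iff.2 hu
  rw [h1, Complex.ofReal_re]
  have : 0 ≤ (-b) * ‖inner ℂ z u‖ ^ 2 / (1 + b * ‖z‖ ^ 2) ^ 2 :=
    div_nonneg (mul_nonneg (neg_nonneg.2 hb) (by positivity)) (by positivity)
  positivity

theorem hermitianForm_self_nonneg (hb : b ≤ 0) {z : Cn N} (hz : z ∈ spaceFormDomain N b)
    (u : Cn N) : 0 ≤ (hermitianForm N b z u u).re := by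
  by_cases hu : u = 0
  · simp [hu]
  · exact (hermitianForm_self_pos hb hz hu).le

end Hermitian

/-! ### Bordered frames -/

section Frame

variable {n N : ℕ} {b : ℝ}

/-- The row vectors `(1, p)` and `(0, E i)`. -/
def frameRow (p : Cn N) (E : Fin n → Cn N) : Matrix (Unit ⊕ Fin n) (Unit ⊕ Fin N) ℂ :=
  fromBlocks 1 (of fun _ l => p l) 0 (of fun i l => E i l)

/-- The column vectors dual to `frameRow p E` for the form `s t̄ + b ∑ x_l ȳ_l`, up to scaling. -/
def frameCol (b : ℝ) (p : Cn N) (E : Fin n → Cn N) : Matrix (Unit ⊕ Fin N) (Unit ⊕ Fin n) ℂ :=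
  fromBlocks 1 0 (of fun l _ => b * conj (p l)) (of fun l j => conj (E j l))

theorem frameRow_mul_frameCol (p : Cn N) (E : Fin n → Cn N) (p' : Cn N) (E' : Fin n → Cn N) :
    frameRow p E * frameCol b p' E' = fromBlocks (of fun _ _ => 1 + b * inner ℂ p' p)
      (of fun _ j => inner ℂ (E' j) p) (of fun i _ => b * inner ℂ p' (E i))
      (of fun i j => inner ℂ (E' j) (E i)) := by
  rw [frameRow, frameCol, fromBlocks_multiply]
  congr 1 <;> ext i j <;>
    simp [Matrix.mul_apply, inner_complex_eq_sum, Finset.mul_sum, mul_left_comm]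

theorem inner_self_cast (p : Cn N) : inner ℂ p p = ((‖p‖ ^ 2 : ℝ) : ℂ) := by
  rw [inner_self_eq_norm_sq_to_K]
  push_cast
  simp

/-! ### Schur complements of bordered matrices -/

section Bordered

variable {ι : Type*} [Fintype ι] [DecidableEq ι] {q : ℂ} (B : Matrix ι (Fin n) ℂ)
  (C : Matrix (Fin n) ι ℂ) (G : Matrix (Fin n) (Fin n) ℂ)

/-- Block elimination: the lower right corner is chosen so that its Schur complement is exactly `q •
G`. -/
theorem det_bordered (hq : q ≠ 0) :
    (fromBlocks (q • (1 : Matrix ι ι ℂ)) B C (q • G + C * q⁻¹ • B)).det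
      = q ^ (Fintype.card ι + n) * G.det := by
  have : fromBlocks (q • (1 : Matrix ι ι ℂ)) B C (q • G + C * q⁻¹ • B)
      = fromBlocks 1 0 (q⁻¹ • C) 1 * fromBlocks (q • 1) B 0 (q • G) := by
    rw [fromBlocks_multiply]
    congr 1
    · simp
    · simp
    · simp [hq]
    · simp [add_comm]
  rw [this, det_mul, det_fromBlocks_zero₁₂, det_fromBlocks_zero₂₁, det_smul, det_smul]
  simp
  ring

/-- The product with the inverse is found by solving the block system explicitly. Its first block
column is zero and its lower right block is `G⁻¹ * X`, which alone enters the trace. -/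
theorem trace_inv_bordered_mul (hq : q ≠ 0) (hG : IsUnit G.det) (X : Matrix (Fin n) (Fin n) ℂ) :
    ((fromBlocks (q • (1 : Matrix ι ι ℂ)) B C (q • G + C * q⁻¹ • B))⁻¹
      * fromBlocks 0 0 0 (q • X)).trace = (G⁻¹ * X).trace := by
  have hdet := det_bordered B C G hq
  set A := fromBlocks (q • (1 : Matrix ι ι ℂ)) B C (q • G + C * q⁻¹ • B) with hA
  have h1 : (fromBlocks 0 0 0 (q • X) : Matrix (ι ⊕ Fin n) (ι ⊕ Fin n) ℂ)
      = A * fromBlocks 0 (-(q⁻¹ • B * (G⁻¹ * X))) 0 (G⁻¹ * X) := by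
    rw [hA, fromBlocks_multiply]
    congr 1
    · simp
    · simp [hq]
    · simp
    · simp only [Matrix.add_mul, Matrix.mul_neg, Matrix.mul_assoc, smul_mul,
        Matrix.mul_nonsing_inv_cancel_left _ _ hG]
      abel
  have h2 : IsUnit A.det := by
    rw [hdet]
    exact (isUnit_iff_ne_zero.2 (pow_ne_zero _ hq)).mul hG
  rw [h1, Matrix.nonsing_inv_mul_cancel_left _ _ h2]
  simp [Matrix.trace, Fintype.sum_sum_type]

end Bordered

/-- The correction term in `hermitianForm_eq` is precisely the rank-one term of a Schur complement,
so bordering by `(1, p)` trades the curved metric for Euclidean inner products. -/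
theorem frame_schur {p : Cn N} (hp : p ∈ spaceFormDomain N b) (E : Fin n → Cn N) :
    frameRow p E * frameCol b p E = fromBlocks (((1 + b * ‖p‖ ^ 2 : ℝ) : ℂ) • 1)
      (of fun _ j => inner ℂ (E j) p) (of fun i _ => b * inner ℂ p (E i))
      (((1 + b * ‖p‖ ^ 2 : ℝ) : ℂ) • gramMatrix (hermitianForm N b p) E
        + (of fun i _ => b * inner ℂ p (E i) : Matrix (Fin n) Unit ℂ)
          * ((1 + b * ‖p‖ ^ 2 : ℝ) : ℂ)⁻¹ •
            (of fun _ j => inner ℂ (E j) p : Matrix Unit (Fin n) ℂ)) := by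
  have hz : ((1 + b * ‖p‖ ^ 2 : ℝ) : ℂ) ≠ 0 := by exact_mod_cast ne_of_gt hp
  rw [frameRow_mul_frameCol]
  congr 1
  · ext i j
    rw [of_apply, inner_self_cast]
    simp
  · ext i j
    simp only [Matrix.add_apply, Matrix.smul_apply, gramMatrix, of_apply, hermitianForm_eq hp,
      Matrix.mul_apply, Finset.univ_unique, Finset.sum_singleton, smul_eq_mul]
    field_simp
    ring

theorem det_frame {p : Cn N} (hp : p ∈ spaceFormDomain N b) (E : Fin n → Cn N) :
    (frameRow p E * frameCol b p E).det
      = ((1 + b * ‖p‖ ^ 2 : ℝ) : ℂ) ^ (n + 1) * (gramMatrix (hermitianForm N b p) E).det := by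
  have hz : ((1 + b * ‖p‖ ^ 2 : ℝ) : ℂ) ≠ 0 := by exact_mod_cast ne_of_gt hp
  rw [frame_schur hp, det_bordered _ _ _ hz, Fintype.card_unit, add_comm 1 n]

theorem trace_inv_frame_mul {p : Cn N} (hp : p ∈ spaceFormDomain N b) (E : Fin n → Cn N)
    (hG : IsUnit (gramMatrix (hermitianForm N b p) E).det) (X : Matrix (Fin n) (Fin n) ℂ) :
    ((frameRow p E * frameCol b p E)⁻¹
      * fromBlocks 0 0 0 (((1 + b * ‖p‖ ^ 2 : ℝ) : ℂ) • X)).trace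
      = ((gramMatrix (hermitianForm N b p) E)⁻¹ * X).trace := by
  have hz : ((1 + b * ‖p‖ ^ 2 : ℝ) : ℂ) ≠ 0 := by exact_mod_cast ne_of_gt hp
  rw [frame_schur hp, trace_inv_bordered_mul _ _ _ hz hG]

end Frame

end KahlerGeometry

namespace KahlerGeometry

open Complex ComplexConjugate Metric Matrix

/-! ### Holomorphic frames along curves -/

section Curve

variable {n N : ℕ} {b : ℝ}

theorem hasDerivAt_apply {f : ℂ → Cn N} {f' : Cn N} {z : ℂ} (hf : HasDerivAt f f' z) (l : Fin N) :
    HasDerivAt (fun z => f z l) (f' l) z :=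
  (EuclideanSpace.proj (𝕜 := ℂ) l).hasFDerivAt.comp_hasDerivAt z hf

theorem hasDerivAt_conj_apply {f : ℂ → Cn N} {f' : Cn N} {z : ℂ} (hf : HasDerivAt f f' (conj z))
    (l : Fin N) : HasDerivAt (fun z => conj (f (conj z) l)) (conj (f' l)) z := by
  have := (hasDerivAt_apply hf l).conj_conj
  rwa [Complex.conj_conj] at this

theorem hasDerivAt_frameRow {f : ℂ → Cn N} {f' : Cn N} {e : Fin n → ℂ → Cn N} {e' : Fin n → Cn N}
    {z : ℂ} (hf : HasDerivAt f f' z) (he : ∀ i, HasDerivAt (e i) (e' i) z)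
    (i : Unit ⊕ Fin n) (k : Unit ⊕ Fin N) :
    HasDerivAt (fun z => frameRow (f z) (fun i => e i z) i k)
      ((fromBlocks 0 (of fun _ l => f' l) 0 (of fun i l => e' i l) :
        Matrix (Unit ⊕ Fin n) (Unit ⊕ Fin N) ℂ) i k) z := by
  rcases i with i | i <;> rcases k with k | k
  · simpa [frameRow] using hasDerivAt_const z _
  · simpa [frameRow] using hasDerivAt_apply hf k
  · simpa [frameRow] using hasDerivAt_const z _
  · simpa [frameRow] using hasDerivAt_apply (he i) k

theorem hasDerivAt_frameCol {f : ℂ → Cn N} {f' : Cn N} {e : Fin n → ℂ → Cn N} {e' : Fin n → Cn N}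
    {z : ℂ} (hf : HasDerivAt f f' (conj z)) (he : ∀ i, HasDerivAt (e i) (e' i) (conj z))
    (k : Unit ⊕ Fin N) (j : Unit ⊕ Fin n) :
    HasDerivAt (fun z => frameCol b (f (conj z)) (fun i => e i (conj z)) k j)
      ((fromBlocks 0 0 (of fun l _ => b * conj (f' l)) (of fun l j => conj (e' j l)) :
        Matrix (Unit ⊕ Fin N) (Unit ⊕ Fin n) ℂ) k j) z := by
  rcases k with k | k <;> rcases j with j | j
  · simpa [frameCol] using hasDerivAt_const z _
  · simpa [frameCol] using hasDerivAt_const z _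
  · simpa [frameCol] using (hasDerivAt_conj_apply hf k).const_mul (b : ℂ)
  · simpa [frameCol] using hasDerivAt_conj_apply (he j) k

/-- The polarized bordered Gram determinant is holomorphic. -/
theorem differentiableAt_det_frame {f : ℂ → Cn N} {e : Fin n → ℂ → Cn N} {p : ℂ × ℂ}
    (hf : DifferentiableAt ℂ f p.1) (he : ∀ i, DifferentiableAt ℂ (e i) p.1)
    (hf' : DifferentiableAt ℂ f (conj p.2)) (he' : ∀ i, DifferentiableAt ℂ (e i) (conj p.2)) :
    DifferentiableAt ℂ (fun p : ℂ × ℂ => (frameRow (f p.1) (fun i => e i p.1)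
      * frameCol b (f (conj p.2)) (fun i => e i (conj p.2))).det) p := by
  simp only [det_apply', Matrix.mul_apply]
  have hentry : ∀ i j, DifferentiableAt ℂ (fun p : ℂ × ℂ => ∑ k, frameRow (f p.1)
      (fun i => e i p.1) i k * frameCol b (f (conj p.2)) (fun i => e i (conj p.2)) k j) p := by
    refine fun i j => DifferentiableAt.fun_sum fun k _ => DifferentiableAt.fun_mul ?_ ?_
    · exact (hasDerivAt_frameRow hf.hasDerivAt
        (fun i => (he i).hasDerivAt) _ _).differentiableAt.comp
        (f := Prod.fst) p differentiableAt_fst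
    · exact (hasDerivAt_frameCol hf'.hasDerivAt
        (fun i => (he' i).hasDerivAt) _ _).differentiableAt.comp
        (f := Prod.snd) p differentiableAt_snd
  refine DifferentiableAt.fun_sum fun σ _ => DifferentiableAt.const_mul ?_ _
  have h := HasFDerivAt.finsetProd (u := Finset.univ) fun i _ => (hentry (σ i) i).hasFDerivAt
  exact h.differentiableAt.congr_of_eventuallyEq
    (Filter.Eventually.of_forall fun p => by simp)

theorem differentiableAt_polarized_inner {f : ℂ → Cn N} {p : ℂ × ℂ}
    (hf : DifferentiableAt ℂ f p.1) (hf' : DifferentiableAt ℂ f (conj p.2)) :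
    DifferentiableAt ℂ (fun p : ℂ × ℂ => ∑ l, f p.1 l * conj (f (conj p.2) l)) p := by
  refine DifferentiableAt.fun_sum fun l _ => DifferentiableAt.fun_mul ?_ ?_
  · exact (hasDerivAt_apply hf.hasDerivAt l).differentiableAt.comp
      (f := Prod.fst) p differentiableAt_fst
  · exact (hasDerivAt_conj_apply hf'.hasDerivAt l).differentiableAt.comp
      (f := Prod.snd) p differentiableAt_snd

theorem conj_mem_ball {r : ℝ} {z : ℂ} (hz : z ∈ ball (0 : ℂ) r) : conj z ∈ ball (0 : ℂ) r := by
  simpa using hz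

/-- If the logarithm of the bordered Gram determinant differs from a multiple of the potential by
a harmonic function, then the polarized determinant factors accordingly. -/
theorem exists_factorization {r c : ℝ} (hb : b ≤ 0) {f : ℂ → Cn N}
    {e : Fin n → ℂ → Cn N} (hf : DifferentiableOn ℂ f (ball 0 r))
    (he : ∀ i, DifferentiableOn ℂ (e i) (ball 0 r))
    (hdom : ∀ z ∈ ball (0 : ℂ) r, f z ∈ spaceFormDomain N b) {D : ℂ → ℝ}
    (hD : ∀ z ∈ ball (0 : ℂ) r, 0 < D z)
    (hdet : ∀ z ∈ ball (0 : ℂ) r, (frameRow (f z) (fun i => e i z)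
      * frameCol b (f z) (fun i => e i z)).det = D z)
    (hharm : InnerProductSpace.HarmonicOnNhd
      (fun z => Real.log (D z) - c * spaceFormPotential N b (f z)) (ball 0 r)) :
    ∃ h : ℂ → ℂ, DifferentiableOn ℂ h (ball 0 r) ∧
      ∀ z ∈ ball (0 : ℂ) (r / 2), ∀ w ∈ ball (0 : ℂ) (r / 2),
        (frameRow (f z) (fun i => e i z)
          * frameCol b (f (conj w)) (fun i => e i (conj w))).det
        = exp (h z) * exp (conj (h (conj w))
          + c * potentialFun b (∑ l, f z l * conj (f (conj w) l))) := by
  -- On a disc a harmonic function is `Re h₀ = h₀/2 + conj (h₀/2)`; the two halves become the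
  -- separate factors in `z` and `w`.
  obtain ⟨h₀, hh₀, hre⟩ := hharm.exists_analyticOnNhd_ball_re_eq
  have hh : DifferentiableOn ℂ (fun z => h₀ z / 2) (ball 0 r) :=
    hh₀.differentiableOn.div_const 2
  refine ⟨fun z => h₀ z / 2, hh, fun z hz w hw => ?_⟩
  set W : ℂ × ℂ → ℂ := fun p => (frameRow (f p.1) (fun i => e i p.1)
      * frameCol b (f (conj p.2)) (fun i => e i (conj p.2))).det
    - exp (h₀ p.1 / 2) * exp (conj (h₀ (conj p.2) / 2)
          + c * potentialFun b (∑ l, f p.1 l * conj (f (conj p.2) l))) with hW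
  have hmem : ∀ z ∈ ball (0 : ℂ) r, ball (0 : ℂ) r ∈ nhds z := fun z hz => isOpen_ball.mem_nhds hz
  have hWd : DifferentiableOn ℂ W (ball 0 r ×ˢ ball 0 r) := by
    rintro p ⟨hp1, hp2⟩
    have hp2' := conj_mem_ball hp2
    have hf1 := hf.differentiableAt (hmem _ hp1)
    have hf2 := hf.differentiableAt (hmem _ hp2')
    have hs := norm_sum_mul_conj_lt hb (hdom _ hp1) (hdom _ hp2')
    have h1 : DifferentiableAt ℂ (fun p : ℂ × ℂ => h₀ p.1 / 2) p :=
      (hh.differentiableAt (hmem _ hp1)).comp (f := Prod.fst) p differentiableAt_fst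
    have h2 : DifferentiableAt ℂ (fun p : ℂ × ℂ => conj (h₀ (conj p.2) / 2)) p := by
      have h3 : DifferentiableAt ℂ (fun w => conj (h₀ (conj w) / 2)) p.2 := by
        have := (hh.differentiableAt (hmem _ hp2')).hasDerivAt.conj_conj.differentiableAt
        rwa [Complex.conj_conj] at this
      exact h3.comp (f := Prod.snd) p differentiableAt_snd
    have h4 : DifferentiableAt ℂ
        (fun p : ℂ × ℂ => potentialFun b (∑ l, f p.1 l * conj (f (conj p.2) l))) p :=
      (hasDerivAt_potentialFun hb hs).differentiableAt.comp
        (f := fun p : ℂ × ℂ => ∑ l, f p.1 l * conj (f (conj p.2) l)) p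
        (differentiableAt_polarized_inner hf1 hf2)
    exact ((differentiableAt_det_frame hf1 (fun i => (he i).differentiableAt (hmem _ hp1)) hf2
      (fun i => (he i).differentiableAt (hmem _ hp2'))).sub
        (h1.cexp.mul (h2.add (h4.const_mul _)).cexp)).differentiableWithinAt
  -- On `w = z̄` the claim is the exponential of the known real identity; `eq_zero_of_eq_zero_conj`
  -- extends it at the price of half the radius.
  refine sub_eq_zero.1 (eq_zero_of_eq_zero_conj (H := W) hWd (fun z hz => ?_) hz hw)
  simp only [hW, Complex.conj_conj]
  rw [hdet z hz, potentialFun_norm_sq (hdom z hz), ← exp_add, sub_eq_zero]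
  have h1 : (h₀ z).re = Real.log (D z) - c * spaceFormPotential N b (f z) := hre hz
  have h2 : h₀ z / 2 + (conj (h₀ z / 2) + c * spaceFormPotential N b (f z))
      = ((Real.log (D z) : ℝ) : ℂ) := by
    rw [← add_assoc, Complex.add_conj, show (h₀ z / 2).re = (h₀ z).re / 2 by simp, h1]
    push_cast
    ring
  rw [h2, ← Complex.ofReal_exp, Real.exp_log (hD z hz)]

/-- In the situation of `exists_factorization` the multiple of the potential is nonpositive. -/
theorem nonpos_of_factorization {r c : ℝ} (hb : b ≤ 0) {f : ℂ → Cn N}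
    {e : Fin n → ℂ → Cn N} (hr : 0 < r) (hf : DifferentiableOn ℂ f (ball 0 r))
    (hne : deriv f 0 ≠ 0) (hdom : ∀ z ∈ ball (0 : ℂ) r, f z ∈ spaceFormDomain N b) {h : ℂ → ℂ}
    (hfac : ∀ z ∈ ball (0 : ℂ) r, ∀ w ∈ ball (0 : ℂ) r,
        (frameRow (f z) (fun i => e i z)
          * frameCol b (f (conj w)) (fun i => e i (conj w))).det
        = exp (h z) * exp (conj (h (conj w))
          + c * potentialFun b (∑ l, f z l * conj (f (conj w) l)))) : c ≤ 0 := by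
  by_contra! hc
  have h0 : (0 : ℂ) ∈ ball (0 : ℂ) r := mem_ball_self hr
  have hd := (hf.differentiableAt (isOpen_ball.mem_nhds h0)).hasDerivAt
  obtain ⟨z₁, hz₁, hz₁'⟩ : ∃ z, f z ≠ f 0 ∧ z ∈ ball (0 : ℂ) r := by
    have h1 := hd.eventually_ne (c := f 0) hne
    have h2 : ∀ᶠ z in nhdsWithin (0 : ℂ) {0}ᶜ, z ∈ ball (0 : ℂ) r :=
      nhdsWithin_le_nhds (isOpen_ball.mem_nhds h0)
    exact (h1.and h2).exists
  -- Dividing by the two exponential factors preserves finite rank, so `exp (c ψ)` would itself be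
  -- of finite rank.
  refine not_isFiniteRankKernel_potentialExp (S := ball 0 r) hb hc
    (convex_ball _ _).isPreconnected hf.continuousOn hdom hz₁' h0 hz₁
    (((IsFiniteRankKernel.det (fun z => frameRow (f z) (fun i => e i z))
      (fun w => frameCol b (f w) (fun i => e i w))).mul
      (IsFiniteRankKernel.mul_fun (fun z => exp (-h z)) (fun w => exp (-conj (h w))))))
    fun z hz w hw => ?_
  have := hfac z hz (conj w) (conj_mem_ball hw)
  simp only [Complex.conj_conj] at this
  rw [this, potentialExp, exp_neg, exp_neg, exp_add]
  field_simp [exp_ne_zero]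

end Curve

end KahlerGeometry

namespace KahlerGeometry

open Complex ComplexConjugate Metric Matrix
open scoped ComplexOrder

/-! ### The Gauss equation along a curve -/

section Gauss

variable {n N : ℕ} {b : ℝ}

/-- The pairing of the bordered vectors with the normal component of a vector. -/
theorem sum_mul_normal {p : Cn N} (hp : p ∈ spaceFormDomain N b) (x ν : Cn N) :
    ∑ l, x l * (conj (ν l) - inner ℂ ν p / (1 + b * ‖p‖ ^ 2 : ℝ) * (b * conj (p l)))
      = (1 + b * ‖p‖ ^ 2 : ℝ) * hermitianForm N b p x ν := by
  have hz : ((1 + b * ‖p‖ ^ 2 : ℝ) : ℂ) ≠ 0 := by exact_mod_cast ne_of_gt hp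
  have h1 : ∀ l, x l * (conj (ν l) - inner ℂ ν p / (1 + b * ‖p‖ ^ 2 : ℝ) * (b * conj (p l)))
      = x l * conj (ν l)
        - inner ℂ ν p / (1 + b * ‖p‖ ^ 2 : ℝ) * b * (x l * conj (p l)) := fun l => by ring
  simp only [h1, Finset.sum_sub_distrib, ← Finset.mul_sum, ← inner_complex_eq_sum]
  rw [hermitianForm_eq hp]
  field_simp

/-- The component of the derivative of `frameCol` normal to `frameRow`. -/
noncomputable def normalCol (b : ℝ) (p : Cn N) (ν : Fin n → Cn N) :
    Matrix (Unit ⊕ Fin N) (Unit ⊕ Fin n) ℂ :=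
  fromBlocks 0 (of fun _ j => -(inner ℂ (ν j) p / (1 + b * ‖p‖ ^ 2 : ℝ))) 0
    (of fun l j => conj (ν j l) - inner ℂ (ν j) p / (1 + b * ‖p‖ ^ 2 : ℝ) * (b * conj (p l)))

/-- The multiple of the column of `p` subtracted in `normalCol` makes it orthogonal to `(1, p)`; its
pairing with `(0, x)` is then `1 + b‖p‖²` times the Hermitian pairing of `x` and `ν`. -/
theorem frameRow_mul_normalCol {p : Cn N} (hp : p ∈ spaceFormDomain N b) {E ν : Fin n → Cn N}
    (hν : ∀ i j, hermitianForm N b p (E i) (ν j) = 0) : frameRow p E * normalCol b p ν = 0 := by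
  have hz : ((1 + b * ‖p‖ ^ 2 : ℝ) : ℂ) ≠ 0 := by exact_mod_cast ne_of_gt hp
  rw [frameRow, normalCol, fromBlocks_multiply, ← fromBlocks_zero]
  congr 1
  · simp
  · ext i j
    simp only [Matrix.one_mul, Matrix.add_apply, of_apply, Matrix.mul_apply, sum_mul_normal hp,
      Matrix.zero_apply]
    rw [hermitianForm_eq hp, inner_self_cast]
    field_simp
    push_cast
    ring
  · simp
  · ext i j
    simp [Matrix.mul_apply, sum_mul_normal hp, hν, -Complex.ofReal_add]

/-- The derivative `(0, f')` of the first row is tangential and drops out, leaving only the Gram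
matrix of the normal parts. -/
theorem derivRow_mul_normalCol {p f' : Cn N} (hp : p ∈ spaceFormDomain N b)
    {e' ν : Fin n → Cn N} (hf' : ∀ j, hermitianForm N b p f' (ν j) = 0)
    (hν : ∀ i j, hermitianForm N b p (e' i) (ν j) = hermitianForm N b p (ν i) (ν j)) :
    (fromBlocks 0 (of fun _ l => f' l) 0 (of fun i l => e' i l) :
        Matrix (Unit ⊕ Fin n) (Unit ⊕ Fin N) ℂ) * normalCol b p ν
      = fromBlocks 0 0 0
        (((1 + b * ‖p‖ ^ 2 : ℝ) : ℂ) • gramMatrix (hermitianForm N b p) ν) := by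
  rw [normalCol, fromBlocks_multiply]
  congr 1
  · simp
  · ext i j
    simp [Matrix.mul_apply, sum_mul_normal hp, hf', -Complex.ofReal_add]
  · simp
  · ext i j
    simp [Matrix.mul_apply, sum_mul_normal hp, hν, gramMatrix, -Complex.ofReal_add]

/-- Puts the derivative of the columns in the form `R 0 * Δ + M` required by
`trace_inv_mul_normal_eq`: tangential parts recombine existing columns. -/
theorem derivCol_eq {p f' : Cn N} {e e' ν : Fin n → Cn N} {a : Fin n → ℂ}
    {Γ : Matrix (Fin n) (Fin n) ℂ} (hf' : f' = ∑ k, a k • e k)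
    (he' : ∀ j, e' j = ∑ k, Γ j k • e k + ν j) :
    (fromBlocks 0 0 (of fun l _ => b * conj (f' l)) (of fun l j => conj (e' j l)) :
        Matrix (Unit ⊕ Fin N) (Unit ⊕ Fin n) ℂ)
      = frameCol b p e * (fromBlocks 0
          (of fun _ j => inner ℂ (ν j) p / (1 + b * ‖p‖ ^ 2 : ℝ))
          (of fun k _ => b * conj (a k)) (of fun k j => conj (Γ j k)) :
            Matrix (Unit ⊕ Fin n) (Unit ⊕ Fin n) ℂ)
        + normalCol b p ν := by
  rw [frameCol, normalCol, fromBlocks_multiply, fromBlocks_add]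
  congr 1
  · simp
  · ext i j
    simp
  · ext l j
    simp only [hf', Matrix.add_apply, of_apply, Matrix.mul_apply, Matrix.zero_apply, mul_zero,
      Finset.sum_const_zero, zero_add, add_zero, WithLp.ofLp_sum, Finset.sum_apply, PiLp.smul_apply,
      smul_eq_mul, map_sum, map_mul, Finset.mul_sum]
    exact Finset.sum_congr rfl fun k _ => by ring
  · ext l j
    simp only [he', Matrix.add_apply, of_apply, Matrix.mul_apply, WithLp.ofLp_sum,
      Finset.sum_apply, PiLp.smul_apply, PiLp.add_apply, smul_eq_mul, map_sum, map_mul, map_add,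
      Finset.univ_unique, Finset.sum_singleton]
    rw [Finset.sum_congr rfl fun k _ => mul_comm (conj (Γ j k)) (conj (e k l))]
    ring

/-- **Gauss equation**: the trace of the Gram matrix of the normal components of the second
derivatives. -/
theorem trace_gauss {r c : ℝ} (hb : b ≤ 0) {f : ℂ → Cn N} {e : Fin n → ℂ → Cn N} (hr : 0 < r)
    (hf : DifferentiableOn ℂ f (ball 0 r)) (he : ∀ i, DifferentiableOn ℂ (e i) (ball 0 r))
    (hdom : ∀ z ∈ ball (0 : ℂ) r, f z ∈ spaceFormDomain N b) {h : ℂ → ℂ}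
    (hh : DifferentiableOn ℂ h (ball 0 r))
    (hfac : ∀ z ∈ ball (0 : ℂ) r, ∀ w ∈ ball (0 : ℂ) r,
        (frameRow (f z) (fun i => e i z)
          * frameCol b (f (conj w)) (fun i => e i (conj w))).det
        = exp (h z) * exp (conj (h (conj w))
          + c * potentialFun b (∑ l, f z l * conj (f (conj w) l))))
    {a : Fin n → ℂ} (hf' : deriv f 0 = ∑ k, a k • e k 0)
    {Γ : Matrix (Fin n) (Fin n) ℂ} {ν : Fin n → Cn N}
    (he' : ∀ j, deriv (e j) 0 = ∑ k, Γ j k • e k 0 + ν j)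
    (hν : ∀ i k, hermitianForm N b (f 0) (ν i) (e k 0) = 0)
    (hG : IsUnit (gramMatrix (hermitianForm N b (f 0)) fun i => e i 0).det) :
    ((gramMatrix (hermitianForm N b (f 0)) fun i => e i 0)⁻¹
      * gramMatrix (hermitianForm N b (f 0)) ν).trace
      = c * hermitianForm N b (f 0) (deriv f 0) (deriv f 0) := by
  have h0 : (0 : ℂ) ∈ ball (0 : ℂ) r := mem_ball_self hr
  have hp := hdom 0 h0
  have hn0 : ball (0 : ℂ) r ∈ nhds 0 := isOpen_ball.mem_nhds h0
  have hfd := (hf.differentiableAt hn0).hasDerivAt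
  have hed := fun i => ((he i).differentiableAt hn0).hasDerivAt
  have hz : ((1 + b * ‖f 0‖ ^ 2 : ℝ) : ℂ) ≠ 0 := by exact_mod_cast ne_of_gt hp
  have hν' : ∀ i j, hermitianForm N b (f 0) (e i 0) (ν j) = 0 := fun i j => by
    rw [hermitianForm_conj hp, hν, map_zero]
  have hfν : ∀ j, hermitianForm N b (f 0) (deriv f 0) (ν j) = 0 := fun j => by
    simp [hf', hν']
  have heν : ∀ i j, hermitianForm N b (f 0) (deriv (e i) 0) (ν j)
      = hermitianForm N b (f 0) (ν i) (ν j) := fun i j => by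
    simp [he', hν']
  -- `Γ := 0` suffices: the row derivatives need no splitting, because their tangential parts pair
  -- to zero with `normalCol`.
  have key := trace_inv_mul_normal_eq (L := fun z => frameRow (f z) fun i => e i z)
    (R := fun w => frameCol b (f (conj w)) fun i => e i (conj w))
    (N := fromBlocks 0 (of fun _ l => deriv f 0 l) 0 (of fun i l => deriv (e i) 0 l))
    (M := normalCol b (f 0) ν) (Γ := 0)
    (Δ := fromBlocks 0 (of fun _ j => inner ℂ (ν j) (f 0) / (1 + b * ‖f 0‖ ^ 2 : ℝ))
      (of fun k _ => b * conj (a k)) (of fun k j => conj (Γ j k)))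
    (E := fun z => exp (h z))
    (θ := fun z w => conj (h (conj w)) + c * potentialFun b (∑ l, f z l * conj (f (conj w) l)))
    (θw := fun z => conj (deriv h 0) + c * (1 / (1 + b * inner ℂ (f 0) (f z))
      * inner ℂ (deriv f 0) (f z)))
    (θzw := c * hermitianForm N b (f 0) (deriv f 0) (deriv f 0))
    (fun i j => by simpa using hasDerivAt_frameRow hfd hed i j)
    (fun i j => by
      have := hasDerivAt_frameCol (b := b) (z := 0) (f := f) (e := e) (f' := deriv f 0)
        (e' := fun i => deriv (e i) 0) (by rw [map_zero]; exact hfd)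
        (fun i => by rw [map_zero]; exact hed i) i j
      rw [derivCol_eq (p := f 0) hf' he'] at this
      simpa using this)
    (frameRow_mul_normalCol hp hν')
    (by
      simp only [map_zero]
      rw [det_frame hp]
      exact mul_ne_zero (pow_ne_zero _ hz) hG.ne_zero)
    (by
      filter_upwards [hn0] with z hz
      filter_upwards [hn0] with w hw
      exact hfac z hz w hw)
    (by
      filter_upwards [hn0] with z hz
      have h1 : HasDerivAt (fun w => conj (h (conj w))) (conj (deriv h 0)) 0 := by
        have := (hh.differentiableAt hn0).hasDerivAt.conj_conj
        rwa [map_zero] at this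
      have h2 : HasDerivAt (fun w => ∑ l, f z l * conj (f (conj w) l))
          (inner ℂ (deriv f 0) (f z)) 0 := by
        rw [inner_complex_eq_sum]
        exact HasDerivAt.fun_sum fun l _ =>
          (hasDerivAt_conj_apply (by simpa using hfd) l).const_mul _
      have h3 : HasDerivAt (potentialFun b) (1 / (1 + b * inner ℂ (f 0) (f z)))
          (∑ l, f z l * conj (f (conj 0) l)) := by
        rw [inner_complex_eq_sum, map_zero]
        exact hasDerivAt_potentialFun hb (norm_sum_mul_conj_lt hb (hdom z hz) hp)
      exact h1.add ((HasDerivAt.comp (h₂ := potentialFun b)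
        (h := fun w => ∑ l, f z l * conj (f (conj w) l)) 0 h3 h2).const_mul (c : ℂ)))
    (by
      -- Differentiating `⟨f', f(z)⟩ / (1 + b⟨f(0), f(z)⟩)` at `0` recovers the Hermitian metric as
      -- the polarized `∂∂̄` of the potential.
      have hi : ∀ v : Cn N, HasDerivAt (fun z => inner ℂ v (f z)) (inner ℂ v (deriv f 0)) 0 :=
        fun v => (innerSL ℂ v).hasFDerivAt.comp_hasDerivAt 0 hfd
      have hne : (1 : ℂ) + b * inner ℂ (f 0) (f 0) ≠ 0 := by
        rw [inner_self_cast]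
        exact_mod_cast ne_of_gt hp
      have := (((((hi (f 0)).const_mul (b : ℂ)).const_add 1).fun_inv hne).fun_mul
        (hi (deriv f 0))).const_mul (c : ℂ) |>.const_add (conj (deriv h 0))
      simp only [one_div]
      convert! this using 1
      rw [hermitianForm_eq hp]
      have hQ : ((1 + b * ‖f 0‖ ^ 2 : ℝ) : ℂ) = 1 + b * inner ℂ (f 0) (f 0) := by
        rw [inner_self_cast]; push_cast; rfl
      rw [hQ]
      field_simp
      ring)
  rw [← key]
  simp only [map_zero]
  rw [derivRow_mul_normalCol hp hfν heν, trace_inv_frame_mul hp _ hG]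

/-- If the logarithm of the bordered Gram determinant differs from a multiple of the potential by
a harmonic function, then the derivatives of the frame have no normal component. -/
theorem hermitianForm_deriv_eq_zero {r c : ℝ} (hb : b ≤ 0) {f : ℂ → Cn N}
    {e : Fin n → ℂ → Cn N} (hr : 0 < r) (hf : DifferentiableOn ℂ f (ball 0 r))
    (he : ∀ i, DifferentiableOn ℂ (e i) (ball 0 r))
    (hdom : ∀ z ∈ ball (0 : ℂ) r, f z ∈ spaceFormDomain N b) {D : ℂ → ℝ}
    (hD : ∀ z ∈ ball (0 : ℂ) r, 0 < D z)
    (hdet : ∀ z ∈ ball (0 : ℂ) r, (frameRow (f z) (fun i => e i z)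
      * frameCol b (f z) (fun i => e i z)).det = D z)
    (hharm : InnerProductSpace.HarmonicOnNhd
      (fun z => Real.log (D z) - c * spaceFormPotential N b (f z)) (ball 0 r))
    {a : Fin n → ℂ} (hf' : deriv f 0 = ∑ k, a k • e k 0) (hne : deriv f 0 ≠ 0)
    (hG : (gramMatrix (hermitianForm N b (f 0)) fun i => e i 0).PosDef) (i : Fin n) {ξ : Cn N}
    (hξ : ∀ j, hermitianForm N b (f 0) (e j 0) ξ = 0) :
    hermitianForm N b (f 0) (deriv (e i) 0) ξ = 0 := by
  have hp := hdom 0 (mem_ball_self hr)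
  have hsub : ball (0 : ℂ) (r / 2) ⊆ ball 0 r := ball_subset_ball (by linarith)
  obtain ⟨h, hh, hfac⟩ := exists_factorization hb hf he hdom hD hdet hharm
  have hc : c ≤ 0 := nonpos_of_factorization hb (half_pos hr) (hf.mono hsub) hne
    (fun z hz => hdom z (hsub hz)) hfac
  have hGu : IsUnit (gramMatrix (hermitianForm N b (f 0)) fun i => e i 0).det :=
    (Matrix.isUnit_iff_isUnit_det _).1 hG.isUnit
  obtain ⟨Γ, ν, he', hν⟩ := exists_normal_decomposition (S := hermitianForm N b (f 0))
    (fun i => e i 0) (fun i => deriv (e i) 0) hGu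
  have htr := trace_gauss hb (half_pos hr) (hf.mono hsub) (fun i => (he i).mono hsub)
    (fun z hz => hdom z (hsub hz)) (hh.mono hsub) hfac hf' he' hν hGu
  obtain ⟨h1, h2⟩ := trace_inv_mul_eq_zero hG (posSemidef_gramMatrix
    (S := hermitianForm N b (f 0)) (hermitianForm_conj hp) (hermitianForm_self_nonneg hb hp) ν)
  -- The trace is nonnegative, while by the Gauss equation it is `c ≤ 0` times a squared length.
  have h3 := h2 (by
    obtain ⟨h4, h5⟩ := Complex.nonneg_iff.1 h1
    refine Complex.ext (le_antisymm ?_ h4) h5.symm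
    rw [htr, Complex.re_ofReal_mul]
    exact mul_nonpos_of_nonpos_of_nonneg hc (hermitianForm_self_nonneg hb hp _))
  have h4 : ν i = 0 := by
    by_contra hi
    have h5 := hermitianForm_self_pos hb hp hi
    have h6 : hermitianForm N b (f 0) (ν i) (ν i) = 0 := congrFun (congrFun h3 i) i
    rw [h6] at h5
    exact lt_irrefl _ h5
  simp [he', h4, hξ]

end Gauss

end KahlerGeometry

namespace KahlerGeometry

open Complex ComplexConjugate Metric Matrix
open scoped ComplexOrder Laplacian

/-! ### Einstein–Kähler submanifolds -/

section Einstein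

variable {n N : ℕ} {M : Type*} [TopologicalSpace M] [ChartedSpace (Cn n) M]
  {g : KahlerMetric n M} {b : ℝ} {f : M → Cn N} {e : OpenPartialHomeomorph M (Cn n)}

theorem apply_eq_sum_smul {m : ℕ} {V : Type*} [NormedAddCommGroup V] [NormedSpace ℂ V]
    (T : Cn m →L[ℂ] V) (u : Cn m) : T u = ∑ j, u j • T (EuclideanSpace.single j 1) := by
  conv_lhs => rw [eq_sum_smul_single u, map_sum]
  simp

theorem KahlerMetric.contDiffAt_det_coeff (g : KahlerMetric n M) (he : e ∈ atlas (Cn n) M)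
    {x : Cn n} (hx : x ∈ e.target) : ContDiffAt ℝ 2 (fun y => (g.coeff e y).det) x := by
  have h1 : ∀ α β, ContDiffAt ℝ 2 (fun y => g.coeff e y α β) x := fun α β =>
    ((g.smooth e he _ _).contDiffAt (e.open_target.mem_nhds hx)).of_le (by norm_cast)
  simp only [det_apply']
  exact ContDiffAt.sum fun σ _ => contDiffAt_const.mul (contDiffAt_prod fun i _ => h1 _ _)

variable [IsManifold 𝓘(ℂ, Cn n) ω M]

theorem IsKahlerImmersion.coeff_eq (hf : IsKahlerImmersion g b f) (he : e ∈ atlas (Cn n) M)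
    {x : Cn n} (hx : x ∈ e.target) :
    g.coeff e x = gramMatrix (hermitianForm N b ((f ∘ e.symm) x))
      fun i => fderiv ℂ (f ∘ e.symm) x (EuclideanSpace.single i 1) := by
  ext α β
  exact hf.inChart_eq he hx _ _

theorem IsKahlerImmersion.posDef_coeff (hf : IsKahlerImmersion g b f) (he : e ∈ atlas (Cn n) M)
    {x : Cn n} (hx : x ∈ e.target) : (g.coeff e x).PosDef := by
  rw [hf.coeff_eq he hx]
  refine posDef_gramMatrix (S := hermitianForm N b ((f ∘ e.symm) x))
    (hermitianForm_conj (hf.mem_domain _)) fun a ha => ?_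
  have h1 : ∑ i, a i • fderiv ℂ (f ∘ e.symm) x (EuclideanSpace.single i 1)
      = fderiv ℂ (f ∘ e.symm) x (WithLp.toLp 2 a) := by
    rw [apply_eq_sum_smul]
  rw [h1, hermitianForm_apply, ← hf.inChart_eq he hx]
  exact g.inChart_pos he hx fun h => ha (by simpa using h)

theorem IsKahlerImmersion.sum_coeff_eq (hf : IsKahlerImmersion g b f) (he : e ∈ atlas (Cn n) M)
    {x : Cn n} (hx : x ∈ e.target) (u : Cn n) :
    ∑ j, ∑ k, g.coeff e x j k * u j * conj (u k)
      = spaceFormHermitian N b ((f ∘ e.symm) x) (fderiv ℂ (f ∘ e.symm) x u)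
        (fderiv ℂ (f ∘ e.symm) x u) := by
  rw [← hermitianForm_apply, apply_eq_sum_smul, hf.coeff_eq he hx]
  simp only [gramMatrix, of_apply, map_sum, LinearMap.sum_apply, map_smul, LinearMap.smul_apply,
    LinearMap.map_smulₛₗ, smul_eq_mul, Finset.mul_sum]
  rw [Finset.sum_comm]
  exact Finset.sum_congr rfl fun j _ => Finset.sum_congr rfl fun k _ => by ring

/-- Along a complex line in a chart, the Einstein condition says that a combination of the logarithm
of the volume density and of the potential is harmonic. -/
theorem IsKahlerImmersion.harmonicOnNhd (hf : IsKahlerImmersion g b f) (he : e ∈ atlas (Cn n) M)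
    {lam : ℝ} (hlam : ∀ x ∈ e.target, ∀ α β, g.ricciCoeff e x α β = (lam : ℂ) * g.coeff e x α β)
    {x u : Cn n} {S : Set ℂ} (hSo : IsOpen S) (hS : ∀ ζ ∈ S, x + ζ • u ∈ e.target) :
    InnerProductSpace.HarmonicOnNhd
      (((fun y => Real.log (g.coeff e y).det.re) ∘ fun ζ : ℂ => x + ζ • u)
        + (lam / 2) • (spaceFormPotential N b ∘ fun ζ : ℂ => (f ∘ e.symm) (x + ζ • u))) S := by
  have hγ : ∀ ζ, HasDerivAt (fun ζ : ℂ => x + ζ • u) u ζ := fun ζ => by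
    simpa using ((hasDerivAt_id ζ).smul_const u).const_add x
  have hγa : ∀ ζ, AnalyticAt ℂ (fun ζ : ℂ => x + ζ • u) ζ := fun ζ => by fun_prop
  have hlog : ∀ ζ ∈ S, ContDiffAt ℝ 2 (fun y => Real.log (g.coeff e y).det.re) (x + ζ • u) := by
    intro ζ hζ
    have hpos := Complex.pos_iff.1 (hf.posDef_coeff he (hS ζ hζ)).det_pos
    exact ContDiffAt.log (Complex.reCLM.contDiff.contDiffAt.comp _
      (g.contDiffAt_det_coeff he (hS ζ hζ))) hpos.1.ne'
  have hF := hf.analyticOnNhd he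
  have hFγ : ∀ ζ ∈ S, AnalyticAt ℂ (fun ζ : ℂ => (f ∘ e.symm) (x + ζ • u)) ζ := fun ζ hζ =>
    (hF _ (hS ζ hζ)).comp (f := fun ζ : ℂ => x + ζ • u) (hγa ζ)
  have hFd : ∀ ζ ∈ S, deriv (fun ζ : ℂ => (f ∘ e.symm) (x + ζ • u)) ζ
      = fderiv ℂ (f ∘ e.symm) (x + ζ • u) u := fun ζ hζ =>
    ((hF _ (hS ζ hζ)).differentiableAt.hasFDerivAt.comp_hasDerivAt ζ (hγ ζ)).deriv
  have hΦ : ∀ ζ : ℂ, ContDiffAt ℝ 2 (spaceFormPotential N b) ((f ∘ e.symm) (x + ζ • u)) := fun ζ : ℂ =>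
    contDiffAt_spaceFormPotential (hf.mem_domain _)
  have hc1 : ∀ ζ ∈ S, ContDiffAt ℝ 2
      ((fun y => Real.log (g.coeff e y).det.re) ∘ fun ζ : ℂ => x + ζ • u) ζ := fun ζ hζ =>
    (hlog ζ hζ).comp ζ ((hγa ζ).contDiffAt.restrict_scalars ℝ)
  have hc2 : ∀ ζ ∈ S, ContDiffAt ℝ 2
      (spaceFormPotential N b ∘ fun ζ : ℂ => (f ∘ e.symm) (x + ζ • u)) ζ := fun ζ hζ =>
    (hΦ ζ).comp ζ ((hFγ ζ hζ).contDiffAt.restrict_scalars ℝ)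
  have hc3 : ∀ ζ ∈ S, ContDiffAt ℝ 2
      ((lam / 2) • (spaceFormPotential N b ∘ fun ζ : ℂ => (f ∘ e.symm) (x + ζ • u))) ζ :=
    fun ζ hζ => contDiffAt_const.smul (hc2 ζ hζ)
  refine fun ζ hζ => ⟨(hc1 ζ hζ).add (hc3 ζ hζ), ?_⟩
  filter_upwards [hSo.mem_nhds hζ] with z hz
  -- Both Laplacians are multiples of the squared length of `u`: the potential gives `4` times it,
  -- the logarithm `-2 * lam` times it. The `1/2` in `lam / 2` offsets the `-2` in `ricciCoeff`.
  rw [ContDiffAt.laplacian_add (hc1 z hz) (hc3 z hz),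
    InnerProductSpace.laplacian_smul _ (hc2 z hz), laplacian_comp (hγa z) (hlog z hz),
    laplacian_comp (hFγ z hz) (hΦ z), (hγ z).deriv, hFd z hz]
  have h1 := hf.sum_coeff_eq he (hS z hz) u
  rw [spaceFormHermitian] at h1
  rw [← h1]
  have h2 : ∀ j k, complexHessian (fun y => Real.log (g.coeff e y).det.re) (x + z • u) j k
      = ((-(lam / 2) : ℝ) : ℂ) * g.coeff e (x + z • u) j k := by
    intro j k
    have := hlam _ (hS z hz) j k
    rw [KahlerMetric.ricciCoeff] at this
    push_cast
    linear_combination (-(1 / 2 : ℂ)) * this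
  simp only [h2, mul_assoc, ← Finset.mul_sum, Complex.re_ofReal_mul, Pi.zero_apply, smul_eq_mul]
  ring

/-- The second derivatives of an Einstein–Kähler immersion have no normal component. -/
theorem IsKahlerImmersion.hermitian_second_deriv_eq_zero (hf : IsKahlerImmersion g b f)
    (hb : b ≤ 0) (he : e ∈ atlas (Cn n) M) {lam : ℝ}
    (hlam : ∀ x ∈ e.target, ∀ α β, g.ricciCoeff e x α β = (lam : ℂ) * g.coeff e x α β)
    {x : Cn n} (hx : x ∈ e.target) (u v : Cn n) {ξ : Cn N}
    (hξ : ∀ w, spaceFormHermitian N b ((f ∘ e.symm) x) (fderiv ℂ (f ∘ e.symm) x w) ξ = 0) :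
    spaceFormHermitian N b ((f ∘ e.symm) x)
      (fderiv ℂ (fun y => fderiv ℂ (f ∘ e.symm) y v) x u) ξ = 0 := by
  rw [← hermitianForm_apply]
  by_cases hu : u = 0
  · simp [hu]
  set F := f ∘ e.symm with hFdef
  have hF : AnalyticOnNhd ℂ F e.target := hf.analyticOnNhd he
  have hdom : ∀ y, F y ∈ spaceFormDomain N b := fun y => hf.mem_domain _
  have hd2 : ∀ y ∈ e.target, HasFDerivAt (fderiv ℂ F) (fderiv ℂ (fderiv ℂ F) y) y := fun y hy =>
    (hF y hy).fderiv.differentiableAt.hasFDerivAt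
  have hγ : ∀ ζ, HasDerivAt (fun ζ : ℂ => x + ζ • u) u ζ := fun ζ => by
    simpa using ((hasDerivAt_id ζ).smul_const u).const_add x
  obtain ⟨r, hr, hball⟩ : ∃ r > 0, ∀ ζ ∈ ball (0 : ℂ) r, x + ζ • u ∈ e.target := by
    have : ∀ᶠ ζ : ℂ in nhds 0, x + ζ • u ∈ e.target :=
      (hγ 0).continuousAt.eventually_mem (e.open_target.mem_nhds (by simpa using hx))
    exact Metric.eventually_nhds_iff_ball.1 this
  have hfd : ∀ ζ ∈ ball (0 : ℂ) r,
      HasDerivAt (fun ζ : ℂ => F (x + ζ • u)) (fderiv ℂ F (x + ζ • u) u) ζ := fun ζ hζ =>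
    (hF _ (hball ζ hζ)).differentiableAt.hasFDerivAt.comp_hasDerivAt ζ (hγ ζ)
  have hed : ∀ w, ∀ ζ ∈ ball (0 : ℂ) r,
      HasDerivAt (fun ζ : ℂ => fderiv ℂ F (x + ζ • u) w)
        (fderiv ℂ (fderiv ℂ F) (x + ζ • u) u w) ζ := fun w ζ hζ => by
    have h1 := (hd2 _ (hball ζ hζ)).comp_hasDerivAt ζ (hγ ζ)
    simpa using h1.clm_apply (hasDerivAt_const ζ w)
  have h0 : (0 : ℂ) ∈ ball (0 : ℂ) r := mem_ball_self hr
  have hx0 : x + (0 : ℂ) • u = x := by simp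
  have hdet : ∀ ζ ∈ ball (0 : ℂ) r,
      0 < (g.coeff e (x + ζ • u)).det.re ∧ (g.coeff e (x + ζ • u)).det.im = 0 := fun ζ hζ => by
    have := Complex.pos_iff.1 (hf.posDef_coeff he (hball ζ hζ)).det_pos
    exact ⟨this.1, this.2.symm⟩
  have hQ : ∀ y, 0 < 1 + b * ‖F y‖ ^ 2 := hdom
  have key : ∀ i, hermitianForm N b (F x)
      (fderiv ℂ (fderiv ℂ F) x u (EuclideanSpace.single i 1)) ξ = 0 := by
    intro i
    -- Here `log D = (n+1) b Φ + log det g`, and `log det g` is harmonic up to `-(lam/2) Φ`; this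
    -- gives the value of `c`. The coefficients `a := u` express the velocity in the coordinate
    -- frame.
    have h1 := hermitianForm_deriv_eq_zero (c := (n + 1) * b - lam / 2)
      (f := fun ζ : ℂ => F (x + ζ • u))
      (e := fun i ζ => fderiv ℂ F (x + ζ • u) (EuclideanSpace.single i 1))
      (D := fun ζ => (1 + b * ‖F (x + ζ • u)‖ ^ 2) ^ (n + 1) * (g.coeff e (x + ζ • u)).det.re)
      (a := u) (ξ := ξ) hb hr (fun ζ hζ => (hfd ζ hζ).differentiableAt.differentiableWithinAt)
      (fun i ζ hζ => (hed _ ζ hζ).differentiableAt.differentiableWithinAt) (fun ζ _ => hdom _)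
      (fun ζ hζ => mul_pos (pow_pos (hQ _) _) (hdet ζ hζ).1)
      (fun ζ hζ => by
        rw [det_frame (hdom _), ← hf.coeff_eq he (hball ζ hζ), Complex.ofReal_mul,
          Complex.ofReal_pow]
        congr 1
        exact Complex.ext rfl (hdet ζ hζ).2)
      (by
        have h2 := hf.harmonicOnNhd he hlam isOpen_ball hball
        refine fun ζ hζ => (InnerProductSpace.harmonicAt_congr_nhds ?_).1 (h2 ζ hζ)
        filter_upwards [isOpen_ball.mem_nhds hζ] with z hz
        simp only [Pi.add_apply, Pi.smul_apply, Function.comp_apply, smul_eq_mul]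
        rw [Real.log_mul (pow_pos (hQ _) _).ne' (hdet z hz).1.ne', Real.log_pow,
          log_eq_mul_spaceFormPotential]
        simp only [hFdef, Function.comp_apply]
        push_cast
        ring)
      (by
        rw [(hfd 0 h0).deriv, apply_eq_sum_smul])
      (by
        rw [(hfd 0 h0).deriv, hx0]
        intro h3
        have h4 := g.inChart_pos he hx hu
        rw [hf.inChart_eq he hx, ← hermitianForm_apply, h3] at h4
        simp at h4)
      (by
        rw [hx0, ← hf.coeff_eq he hx]
        exact hf.posDef_coeff he hx) i
      (fun j => by
        rw [hx0]
        exact hξ _)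
    rw [(hed _ 0 h0).deriv, hx0] at h1
    exact h1
  have h5 : fderiv ℂ (fun y => fderiv ℂ F y v) x u = fderiv ℂ (fderiv ℂ F) x u v := by
    have := (hd2 x hx).clm_apply (hasFDerivAt_const v x)
    rw [this.fderiv]
    simp
  rw [h5, apply_eq_sum_smul]
  simp [key]

end Einstein

end KahlerGeometry

theorem mainTheorem6 {n N : ℕ} {M : Type*} [TopologicalSpace M]
    [ChartedSpace (KahlerGeometry.Cn n) M]
    [IsManifold 𝓘(ℂ, KahlerGeometry.Cn n) ω M]
    (g : KahlerGeometry.KahlerMetric n M) (hg : g.IsEinstein)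
    (b : ℝ) (hb : b ≤ 0) (f : M → KahlerGeometry.Cn N)
    (hf : KahlerGeometry.IsKahlerImmersion g b f) :
    KahlerGeometry.IsTotallyGeodesic (n := n) b f := by
  obtain ⟨lam, hlam⟩ := hg
  intro e he x hx u v ξ hξ
  exact KahlerGeometry.ambientCovariantDerivative_eq_zero e.open_target (hf.analyticOnNhd he)
    (fun y _ => hf.mem_domain _) hx
    (fun η hη => hf.hermitian_second_deriv_eq_zero hb he (hlam e he) hx u v hη) hξ
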